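/- Let $k\ge 3$. A planar drawing of a finite graph $G$ maps the vertices to distinct points of the plane and each edge to a simple curve joining the points of its ends, so that the curves meet each other and the points of the vertices only at their endpoints; it is a straight-line drawing if all curves are line segments. Two planar drawings of $G$ are equivalent if they have the same facial walks and the same outer face. A plane graph is a graph together with an equivalence class of planar drawings of it. A $k$-angulation is a $2$-connected plane graph in which every internal (that is, bounded) face is a $k$-gon, that is, bounded by a cycle of length $k$. A finite set $P$ of points in the plane admits a plane graph if some straight-line drawing in its class maps the vertices onto $P$. An interior point of $P$ is a point of $P$ that is not on the boundary of the convex hull of $P$. Let $P$ be a finite set of $n=|P|\ge k$ points in the plane, no three of them collinear. Let $j$ be the integer with $j\equiv k-n \pmod{k-2}$ and $0\le j\le k-3$. If $P$ admits a $k$-angulation, then $P$ has at least $j$ interior points. -/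

import Mathlib

/-- The Euclidean plane. -/
abbrev Plane : Type := EuclideanSpace ℝ (Fin 2)

/-- A graph is 2-connected if it has at least three vertices, is connected, and stays connected
when any single vertex is deleted. -/
def SimpleGraph.IsTwoConnected {V : Type*} (G : SimpleGraph V) : Prop :=
  3 ≤ ENat.card V ∧ G.Connected ∧ ∀ v : V, (G.induce {v}ᶜ).Connected

/-- A planar drawing of `G`: distinct vertices go to distinct points, every edge `ab` goes to (the
image of) a simple curve joining the points of `a` and `b`, and the curves meet each other and the
points of the vertices only at their endpoints. -/
structure PlanarDrawing {V : Type*} (G : SimpleGraph V) where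
  /-- the point representing a vertex -/
  point : V → Plane
  /-- the point set of the curve representing an edge -/
  curve : G.edgeSet → Set Plane
  point_injective : Function.Injective point
  curve_simple : ∀ (a b : V) (h : G.Adj a b), ∃ γ : Path (point a) (point b),
    Function.Injective γ ∧ Set.range γ = curve ⟨s(a, b), G.mem_edgeSet.2 h⟩
  curve_inter : ∀ (e f : G.edgeSet), e ≠ f → ∀ x ∈ curve e ∩ curve f,
    ∃ v : V, v ∈ (e : Sym2 V) ∧ v ∈ (f : Sym2 V) ∧ x = point v
  point_mem_curve : ∀ (v : V) (e : G.edgeSet), point v ∈ curve e → v ∈ (e : Sym2 V)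

namespace PlanarDrawing

variable {V : Type*} {G : SimpleGraph V}

/-- A straight-line drawing: every edge is drawn as the segment between its two ends. -/
def IsStraightLine (D : PlanarDrawing G) : Prop :=
  ∀ (a b : V) (h : G.Adj a b),
    D.curve ⟨s(a, b), G.mem_edgeSet.2 h⟩ = segment ℝ (D.point a) (D.point b)

/-- The set of all points of the plane that are used by the drawing. -/
def carrier (D : PlanarDrawing G) : Set Plane :=
  Set.range D.point ∪ ⋃ e, D.curve e

/-- The faces of a drawing: the connected components of the complement of the drawing. -/
def Face (D : PlanarDrawing G) : Type :=
  {F : Set Plane // ∃ x ∈ D.carrierᶜ, F = connectedComponentIn D.carrierᶜ x}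

/-- A face is internal if it is bounded. The drawing of a finite graph is compact, so that exactly
one face is not internal: the outer face. -/
def Face.IsInternal {D : PlanarDrawing G} (F : D.Face) : Prop :=
  Bornology.IsBounded F.1

/-- The edges on the boundary of a face. In a 2-connected graph the boundary of a face is a simple
cycle, and these are its edges. -/
def Face.boundaryEdges {D : PlanarDrawing G} (F : D.Face) : Set G.edgeSet :=
  {e | D.curve e ⊆ frontier F.1}

/-- A face is a `k`-gon if its boundary edges are the edges of a cycle of length `k`. -/
def Face.IsGon {D : PlanarDrawing G} (k : ℕ) (F : D.Face) : Prop :=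
  ∃ (v : V) (w : G.Walk v v), w.IsCycle ∧ w.length = k ∧
    ∀ e : G.edgeSet, e ∈ F.boundaryEdges ↔ (e : Sym2 V) ∈ w.edges

/-- Two drawings of the same graph are equivalent if they have the same facial cycles, and the same
one of the outer face: there is a bijection between their faces that keeps the boundary edges and
takes outer face to outer face. (It is a bijection, not an equality of sets of cycles, because
in a drawing of a cycle two faces have the same boundary. Facial cycles are recorded through their
edges, as is adequate for 2-connected graphs, which are the only ones used here.) -/
def Equivalent (D D' : PlanarDrawing G) : Prop :=
  ∃ σ : D.Face ≃ D'.Face, ∀ F : D.Face,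
    (σ F).boundaryEdges = F.boundaryEdges ∧ ((σ F).IsInternal ↔ F.IsInternal)

/-- Equivalence of planar drawings, as a setoid. -/
instance setoid (G : SimpleGraph V) : Setoid (PlanarDrawing G) where
  r := Equivalent
  iseqv :=
    { refl := fun _ => ⟨Equiv.refl _, fun _ => ⟨rfl, Iff.rfl⟩⟩
      symm := by
        rintro D D' ⟨σ, h⟩
        refine ⟨σ.symm, fun F => ?_⟩
        have := h (σ.symm F)
        rw [Equiv.apply_symm_apply] at this
        exact ⟨this.1.symm, this.2.symm⟩
      trans := by
        rintro D D' D'' ⟨σ, h⟩ ⟨τ, h'⟩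
        exact ⟨σ.trans τ, fun F => ⟨(h' (σ F)).1.trans (h F).1, (h' (σ F)).2.trans (h F).2⟩⟩ }

/-- Every internal face of the drawing is a `k`-gon. -/
def InternalFacesAreGons (k : ℕ) (D : PlanarDrawing G) : Prop :=
  ∀ F : D.Face, F.IsInternal → F.IsGon k

theorem Equivalent.internalFacesAreGons {k : ℕ} {D D' : PlanarDrawing G} (h : D.Equivalent D')
    (hD : D.InternalFacesAreGons k) : D'.InternalFacesAreGons k := by
  obtain ⟨σ, h⟩ := h
  intro F hF
  obtain ⟨F, rfl⟩ := σ.surjective F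
  obtain ⟨v, w, hw, hk, he⟩ := hD F ((h F).2.1 hF)
  refine ⟨v, w, hw, hk, fun e => ?_⟩
  rw [(h F).1]
  exact he e

end PlanarDrawing

/-- A plane graph on the planar graph `G`: an equivalence class of planar drawings of `G`. -/
def PlaneGraph {V : Type*} (G : SimpleGraph V) : Type _ :=
  Quotient (PlanarDrawing.setoid G)

namespace PlaneGraph

variable {V : Type*} {G : SimpleGraph V}

/-- A `k`-angulation is a 2-connected plane graph in which every internal face is a `k`-gon. -/
def IsAngulation (k : ℕ) (𝒢 : PlaneGraph G) : Prop :=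
  G.IsTwoConnected ∧
    Quotient.lift (PlanarDrawing.InternalFacesAreGons k)
      (fun _ _ h => propext ⟨fun hD => PlanarDrawing.Equivalent.internalFacesAreGons h hD,
        fun hD => PlanarDrawing.Equivalent.internalFacesAreGons (Setoid.symm h) hD⟩) 𝒢

end PlaneGraph

/-- The point set `P` admits the plane graph `𝒢` if some straight-line drawing in the class `𝒢`
maps the vertices onto `P`. -/
def Admits {V : Type*} {G : SimpleGraph V} (P : Finset Plane) (𝒢 : PlaneGraph G) : Prop :=
  ∃ D : PlanarDrawing G, D.IsStraightLine ∧ Set.range D.point = (P : Set Plane) ∧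
    (Quotient.mk (PlanarDrawing.setoid G) D : PlaneGraph G) = 𝒢

/-- No three points of `P` are collinear. -/
def InGeneralPosition (P : Finset Plane) : Prop :=
  ∀ a ∈ P, ∀ b ∈ P, ∀ c ∈ P, a ≠ b → a ≠ c → b ≠ c → ¬ Collinear ℝ ({a, b, c} : Set Plane)

/-- The interior points of `P`: those not on the boundary of the convex hull of `P`. -/
def interiorPoints (P : Finset Plane) : Set Plane :=
  {p | p ∈ P ∧ p ∉ frontier (convexHull ℝ (P : Set Plane))}

/-! Let the drawing have n vertices, e edges and m internal faces; let t edges bound the outer face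
and h points lie on the boundary of the convex hull. Euler's formula m = e - n + 1 and the count mk
+ t = 2e of the sides of edges give n - t = (m - 1)(k - 2) + (k - n), so n - t is congruent to j
modulo k - 2. As 0 ≤ n - t, this forces n - t ≥ j. As h ≤ t, the number n - h of interior points is
at least n - t.

Euler's formula comes from squeezing m between dimensions of cycle spaces. Winding numbers embed the
real cycle space into the functions on the internal faces (`finrank_cycleSpace_le`); the boundaries
of the internal faces are independent cycles modulo 2 (`card_internalFace_le`). Both cycle spaces
have dimension e - n + 1 by rank-nullity (`finrank_cycleSpace_add_card`).

The bounds h ≤ t ≤ n hold vertex by vertex: at most two outer boundary edges meet at a vertex, and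
at least two at a hull vertex. No more is needed about the shape of the outer boundary.

The common tool is a function g on the faces that "jumps" at an edge if its values on the two sides
differ. If it jumps nowhere it is constant (`eq_of_forall_noJump`), and it cannot jump at exactly
one edge at a vertex (`exists_eq_of_noJump_of_ne`). The winding number of a cycle jumps exactly at
the edges with nonzero coefficient; the other functions used are predicates on faces and
coefficients of linear relations. -/

open Set Filter Topology

/-! ### Constancy along connected sets -/

/-- A function whose germs relative to `T` are constant at all points of a preconnected set
has the same germ at all these points. -/
theorem IsPreconnected.exists_eventually_nhdsWithin_eq {X α : Type*} [TopologicalSpace X]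
    {S T : Set X} (hS : IsPreconnected S) (hne : S.Nonempty) (g : X → α)
    (hT : ∀ x ∈ S, (𝓝[T] x).NeBot) (hg : ∀ x ∈ S, ∃ c, ∀ᶠ z in 𝓝[T] x, g z = c) :
    ∃ c, ∀ x ∈ S, ∀ᶠ z in 𝓝[T] x, g z = c := by
  obtain ⟨x₀, hx₀⟩ := hne
  obtain ⟨c, hc⟩ := hg x₀ hx₀
  refine ⟨c, fun y hy => ?_⟩
  have key := hS.induction₂' (fun x y => ∀ c, (∀ᶠ z in 𝓝[T] x, g z = c) ↔ ∀ᶠ z in 𝓝[T] y, g z = c)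
    ?_ ?_ hx₀ hy
  · exact (key c).1 hc
  · intro x hx
    obtain ⟨d, hd⟩ := hg x hx
    have h1 : ∀ᶠ y in 𝓝[S] x, ∀ᶠ z in 𝓝[T] y, g z = d := by
      rw [eventually_nhdsWithin_iff] at hd
      exact nhdsWithin_le_nhds ((eventually_eventually_nhds.2 hd).mono
        fun y hy => eventually_nhdsWithin_iff.2 hy)
    filter_upwards [h1, self_mem_nhdsWithin] with y hy hyS
    have huniq : ∀ w ∈ S, (∀ᶠ z in 𝓝[T] w, g z = d) → ∀ c,
        ((∀ᶠ z in 𝓝[T] w, g z = c) ↔ c = d) := by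
      intro w hw hwd c
      refine ⟨fun h => ?_, fun h => h ▸ hwd⟩
      have := hT w hw
      obtain ⟨z, hz1, hz2⟩ := (h.and hwd).exists
      exact hz1.symm.trans hz2
    have : ∀ c, (∀ᶠ z in 𝓝[T] x, g z = c) ↔ ∀ᶠ z in 𝓝[T] y, g z = c := fun c =>
      (huniq x hx hd c).trans (huniq y hyS hy c).symm
    exact ⟨this, fun c => (this c).symm⟩
  · intro a b c _ _ _ hab hbc d
    exact (hab d).trans (hbc d)

/-- Pushing every nonzero point outwards by the distance `R` maps the punctured space, which is
connected, onto the exterior of the ball. -/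
theorem isPreconnected_compl_closedBall_zero {E : Type*} [NormedAddCommGroup E] [NormedSpace ℝ E]
    (h : 1 < Module.rank ℝ E) {R : ℝ} (hR : 0 ≤ R) :
    IsPreconnected (Metric.closedBall (0 : E) R)ᶜ := by
  have h1 := (isConnected_compl_singleton_of_one_lt_rank h (0 : E)).isPreconnected
  have h2 := h1.image (fun x => (1 + R / ‖x‖) • x) (by
    refine ContinuousOn.smul ?_ continuousOn_id
    refine continuousOn_const.add (continuousOn_const.div continuous_norm.continuousOn ?_)
    intro x hx
    simpa using hx)
  convert h2 using 1
  ext y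
  simp only [mem_compl_iff, Metric.mem_closedBall, dist_zero_right, not_le, mem_image,
    mem_singleton_iff]
  constructor
  · intro hy
    have hy0 : 0 < ‖y‖ := hR.trans_lt hy
    refine ⟨(1 - R / ‖y‖) • y, ?_, ?_⟩
    · have : 0 < 1 - R / ‖y‖ := by rw [sub_pos, div_lt_one hy0]; exact hy
      simp [this.ne', norm_pos_iff.1 hy0]
    · have h3 : 0 < 1 - R / ‖y‖ := by rw [sub_pos, div_lt_one hy0]; exact hy
      rw [norm_smul, Real.norm_of_nonneg h3.le, smul_smul]
      have h4 : (1 + R / ((1 - R / ‖y‖) * ‖y‖)) * (1 - R / ‖y‖) = 1 := by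
        have h5 : ‖y‖ - R ≠ 0 := by linarith
        have h6 : (1 - R / ‖y‖) * ‖y‖ = ‖y‖ - R := by field_simp
        rw [h6]
        field_simp
        ring
      rw [h4, one_smul]
  · rintro ⟨x, hx, rfl⟩
    have hx0 : 0 < ‖x‖ := norm_pos_iff.2 hx
    rw [norm_smul, Real.norm_of_nonneg (by positivity), add_mul, div_mul_cancel₀ _ hx0.ne']
    linarith

/-! ### Complex coordinates adapted to a segment -/

namespace Plane

/-- The identification of the Euclidean plane with the complex plane. -/
noncomputable def toComplex : Plane ≃L[ℝ] ℂ :=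
  Complex.orthonormalBasisOneI.repr.symm.toContinuousLinearEquiv

/-- The complex coordinate of a point in which `p` is the origin and `q` is `1`. -/
noncomputable def coord (p q x : Plane) : ℂ :=
  (toComplex x - toComplex p) / (toComplex q - toComplex p)

/-- The open half plane on the left of the line from `p` to `q`. -/
def leftOf (p q : Plane) : Set Plane := {x | 0 < (coord p q x).im}

variable {p q x : Plane}

theorem toComplex_sub_ne_zero (h : p ≠ q) : toComplex q - toComplex p ≠ 0 :=
  sub_ne_zero.2 fun h' => h (toComplex.injective h').symm

theorem continuous_coord (p q : Plane) : Continuous (coord p q) := by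
  unfold coord
  exact (toComplex.continuous.sub continuous_const).div_const _

theorem coord_swap (h : p ≠ q) (x : Plane) : coord q p x = 1 - coord p q x := by
  have h1 := toComplex_sub_ne_zero h
  have h2 := toComplex_sub_ne_zero h.symm
  unfold coord
  field_simp
  ring

theorem coord_combo (a b : ℝ) (hab : a + b = 1) (x y : Plane) :
    coord p q (a • x + b • y) = a * coord p q x + b * coord p q y := by
  unfold coord
  simp only [map_add, map_smul, Complex.real_smul]
  have : (a : ℂ) + b = 1 := by exact_mod_cast hab
  rw [div_eq_mul_inv, div_eq_mul_inv, div_eq_mul_inv]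
  linear_combination toComplex p * (toComplex q - toComplex p)⁻¹ * this

theorem coord_left (p q : Plane) : coord p q p = 0 := by simp [coord]

theorem coord_right (h : p ≠ q) : coord p q q = 1 := div_self (toComplex_sub_ne_zero h)

/-- `coord` as a homeomorphism. -/
noncomputable def coordHomeomorph (h : p ≠ q) : Plane ≃ₜ ℂ where
  toFun := coord p q
  invFun z := toComplex.symm (toComplex p + z * (toComplex q - toComplex p))
  left_inv x := by
    have := toComplex_sub_ne_zero h
    apply toComplex.injective
    simp only [coord, ContinuousLinearEquiv.apply_symm_apply]
    field_simp
    ring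
  right_inv z := by
    have := toComplex_sub_ne_zero h
    simp only [coord, ContinuousLinearEquiv.apply_symm_apply]
    field_simp
    ring
  continuous_toFun := continuous_coord p q
  continuous_invFun := by fun_prop

theorem coord_injective (h : p ≠ q) : Function.Injective (coord p q) :=
  (coordHomeomorph h).injective

theorem mem_segment_iff (h : p ≠ q) :
    x ∈ segment ℝ p q ↔ (coord p q x).im = 0 ∧ 0 ≤ (coord p q x).re ∧ (coord p q x).re ≤ 1 := by
  constructor
  · rintro ⟨a, b, ha, hb, hab, rfl⟩
    rw [coord_combo a b hab, coord_left, coord_right h]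
    simp [hb]
    linarith
  · rintro ⟨h1, h2, h3⟩
    refine ⟨1 - (coord p q x).re, (coord p q x).re, by linarith, h2, by ring, ?_⟩
    apply coord_injective h
    rw [coord_combo _ _ (by ring), coord_left, coord_right h]
    apply Complex.ext <;> simp [h1]

theorem mem_openSegment_iff (h : p ≠ q) :
    x ∈ openSegment ℝ p q ↔
      (coord p q x).im = 0 ∧ 0 < (coord p q x).re ∧ (coord p q x).re < 1 := by
  constructor
  · rintro ⟨a, b, ha, hb, hab, rfl⟩
    rw [coord_combo a b hab, coord_left, coord_right h]
    simp [hb]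
    linarith
  · rintro ⟨h1, h2, h3⟩
    refine ⟨1 - (coord p q x).re, (coord p q x).re, by linarith, h2, by ring, ?_⟩
    apply coord_injective h
    rw [coord_combo _ _ (by ring), coord_left, coord_right h]
    apply Complex.ext <;> simp [h1]

theorem mem_leftOf_swap (h : p ≠ q) : x ∈ leftOf q p ↔ (coord p q x).im < 0 := by
  simp [leftOf, coord_swap h]

theorem convex_leftOf (p q : Plane) : Convex ℝ (leftOf p q) := by
  intro x hx y hy a b ha hb hab
  simp only [leftOf, mem_ofPred_eq] at *
  rw [coord_combo _ _ hab]
  simp only [Complex.add_im, Complex.im_ofReal_mul]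
  rcases ha.eq_or_lt with rfl | ha
  · have : b = 1 := by linarith
    simp [this, hy]
  · have := mul_pos ha hx
    have := mul_nonneg hb hy.le
    linarith

theorem neBot_nhdsWithin_leftOf (h : p ≠ q) (hx : 0 ≤ (coord p q x).im) :
    (𝓝[leftOf p q] x).NeBot := by
  rw [← mem_closure_iff_nhdsWithin_neBot]
  have : leftOf p q = coordHomeomorph h ⁻¹' {z | 0 < z.im} := rfl
  rw [this, ← Homeomorph.preimage_closure, Complex.closure_setOfPred_lt_im]
  exact hx

theorem neBot_nhdsWithin_leftOf_of_mem (h : p ≠ q) (hx : x ∈ segment ℝ p q) :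
    (𝓝[leftOf p q] x).NeBot :=
  neBot_nhdsWithin_leftOf h ((mem_segment_iff h).1 hx).1.ge

/-- Near a point in the interior of a segment, the points off the segment are on one of its two
sides. -/
theorem eventually_mem_openSegment_or (h : p ≠ q) (hx : x ∈ openSegment ℝ p q) :
    ∀ᶠ y in 𝓝 x, y ∈ openSegment ℝ p q ∨ y ∈ leftOf p q ∨ y ∈ leftOf q p := by
  obtain ⟨-, h2, h3⟩ := (mem_openSegment_iff h).1 hx
  have hc : ContinuousAt (fun y => (coord p q y).re) x :=
    (Complex.continuous_re.comp (continuous_coord p q)).continuousAt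
  filter_upwards [hc.eventually_lt_const h3, hc.eventually_const_lt h2] with y h4 h5
  rw [mem_openSegment_iff h, mem_leftOf_swap h]
  rcases lt_trichotomy (coord p q y).im 0 with h6 | h6 | h6
  · exact Or.inr (Or.inr h6)
  · exact Or.inl ⟨h6, h5, h4⟩
  · exact Or.inr (Or.inl h6)

/-- A disc around the origin of a ray minus the ray. -/
theorem isPreconnected_ball_diff_ray (h : p ≠ q) {r : ℝ} (hr : 0 < r) :
    IsPreconnected {x | ‖coord p q x‖ < r ∧ -coord p q x ∈ Complex.slitPlane} := by
  have h1 : IsPreconnected {z : ℂ | ‖z‖ < r ∧ z ∈ Complex.slitPlane} := by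
    -- The slit disc is not convex, but it is star-shaped about any of its points on the positive
    -- real axis.
    have hs : StarConvex ℝ ((r / 2 : ℝ) : ℂ) {z : ℂ | ‖z‖ < r ∧ z ∈ Complex.slitPlane} := by
      have h2 : StarConvex ℝ ((r / 2 : ℝ) : ℂ) (Metric.ball 0 r) :=
        (convex_ball 0 r).starConvex (by simp [abs_of_pos hr]; linarith)
      intro z hz a b ha hb hab
      refine ⟨by simpa using h2 (by simpa using hz.1) ha hb hab, ?_⟩
      rcases hb.eq_or_lt with rfl | hb
      · have : a = 1 := by linarith
        rw [Complex.mem_slitPlane_iff]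
        left
        simp [this, hr]
      · rw [Complex.mem_slitPlane_iff]
        rcases Complex.mem_slitPlane_iff.1 hz.2 with h3 | h3
        · left
          have := mul_pos hb h3
          simp
          positivity
        · right
          simp [hb.ne', h3]
    exact (hs.isPathConnected ⟨by simp [abs_of_pos hr]; linarith,
      Complex.mem_slitPlane_iff.2 (Or.inl (by simp [hr]))⟩).isConnected.isPreconnected
  have h2 := h1.image (fun z => (coordHomeomorph h).symm (-z))
    ((coordHomeomorph h).symm.continuous.comp continuous_neg).continuousOn
  convert h2 using 1
  ext x
  constructor
  · rintro ⟨h3, h4⟩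
    refine ⟨-coord p q x, ⟨by simpa using h3, h4⟩, ?_⟩
    simp only [neg_neg]
    exact (coordHomeomorph h).symm_apply_apply x
  · rintro ⟨z, ⟨h3, h4⟩, rfl⟩
    have : coord p q ((coordHomeomorph h).symm (-z)) = -z :=
      (coordHomeomorph h).apply_symm_apply _
    simp only [mem_ofPred_eq]
    rw [this]
    simpa using ⟨h3, h4⟩

end Plane

/-! ### Faces along the edges and around the vertices of a straight-line drawing -/

namespace PlanarDrawing

open Plane

variable {V : Type*} {G : SimpleGraph V} {D : PlanarDrawing G}

theorem point_ne (D : PlanarDrawing G) (d : G.Dart) : D.point d.fst ≠ D.point d.snd :=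
  fun h => d.fst_ne_snd (D.point_injective h)

/-- The open segment that represents an edge in a straight-line drawing. -/
def openEdge (D : PlanarDrawing G) (d : G.Dart) : Set Plane :=
  openSegment ℝ (D.point d.fst) (D.point d.snd)

/-- The open half plane to the left of a directed edge. -/
def leftHalf (D : PlanarDrawing G) (d : G.Dart) : Set Plane :=
  leftOf (D.point d.fst) (D.point d.snd)

/-- The edge of a dart, as a member of the edge set. -/
def _root_.SimpleGraph.Dart.toEdge (d : G.Dart) : G.edgeSet := ⟨d.edge, d.edge_mem⟩

theorem _root_.SimpleGraph.Dart.toEdge_symm (d : G.Dart) : d.symm.toEdge = d.toEdge :=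
  Subtype.ext d.edge_symm

theorem _root_.SimpleGraph.Dart.exists_toEdge (e : G.edgeSet) : ∃ d : G.Dart, d.toEdge = e := by
  obtain ⟨e, he⟩ := e
  induction e with
  | _ a b => exact ⟨⟨(a, b), he⟩, rfl⟩

theorem _root_.SimpleGraph.Dart.toEdge_eq_iff (d d' : G.Dart) :
    d.toEdge = d'.toEdge ↔ d = d' ∨ d = d'.symm := by
  rw [← SimpleGraph.dart_edge_eq_iff]
  exact Subtype.ext_iff

theorem IsStraightLine.curve_toEdge (hD : D.IsStraightLine) (d : G.Dart) :
    D.curve d.toEdge = segment ℝ (D.point d.fst) (D.point d.snd) :=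
  hD d.fst d.snd d.adj

theorem openEdge_symm (d : G.Dart) : D.openEdge d.symm = D.openEdge d :=
  openSegment_symm _ _ _

theorem IsStraightLine.openEdge_subset_curve (hD : D.IsStraightLine) (d : G.Dart) :
    D.openEdge d ⊆ D.curve d.toEdge := by
  rw [hD.curve_toEdge]
  exact openSegment_subset_segment _ _ _

theorem curve_subset_carrier (e : G.edgeSet) : D.curve e ⊆ D.carrier :=
  fun _ hx => Or.inr (mem_iUnion.2 ⟨e, hx⟩)

theorem openEdge_nonempty (d : G.Dart) : (D.openEdge d).Nonempty :=
  ⟨_, (1 / 2 : ℝ), (1 / 2 : ℝ), by norm_num, by norm_num, by norm_num, rfl⟩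

theorem point_notMem_openEdge (d : G.Dart) (v : V) (hD : D.IsStraightLine) :
    D.point v ∉ D.openEdge d := by
  intro h
  have h1 := D.point_mem_curve v d.toEdge (hD.openEdge_subset_curve d h)
  have h2 := (mem_openSegment_iff (D.point_ne d)).1 h
  rcases Sym2.mem_iff.1 h1 with rfl | rfl
  · simp [coord_left] at h2
  · simp [coord_right (D.point_ne d)] at h2

theorem IsStraightLine.isCompact_curve (hD : D.IsStraightLine) (e : G.edgeSet) :
    IsCompact (D.curve e) := by
  obtain ⟨d, rfl⟩ := SimpleGraph.Dart.exists_toEdge e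
  rw [hD.curve_toEdge, segment_eq_image]
  exact isCompact_Icc.image (by fun_prop)

theorem leftHalf_disjoint_curve (hD : D.IsStraightLine) {d : G.Dart} {y : Plane}
    (hy : y ∈ D.leftHalf d) : y ∉ D.curve d.toEdge := by
  rw [hD.curve_toEdge, mem_segment_iff (D.point_ne d)]
  exact fun h => hy.ne' h.1

theorem IsStraightLine.eventually_mem_leftHalf_or (hD : D.IsStraightLine) {d : G.Dart} {x : Plane}
    (hx : x ∈ D.openEdge d) :
    ∀ᶠ y in 𝓝 x, y ∉ D.carrier → y ∈ D.leftHalf d ∨ y ∈ D.leftHalf d.symm := by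
  filter_upwards [eventually_mem_openSegment_or (D.point_ne d) hx] with y hy hyc
  rcases hy with hy | hy
  · exact absurd (curve_subset_carrier _ (hD.openEdge_subset_curve d hy)) hyc
  · exact hy

/-- The component of a point in the complement of the drawing. -/
def comp (D : PlanarDrawing G) (x : Plane) : Set Plane := connectedComponentIn D.carrierᶜ x

theorem comp_eq_of_isPreconnected {H : Set Plane} (hH : IsPreconnected H) (hHc : H ⊆ D.carrierᶜ)
    {x y : Plane} (hx : x ∈ H) (hy : y ∈ H) : D.comp x = D.comp y :=
  connectedComponentIn_eq (hH.subset_connectedComponentIn hx hHc hy)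

theorem mem_comp {x : Plane} (hx : x ∉ D.carrier) : x ∈ D.comp x := mem_connectedComponentIn hx

theorem neBot_leftHalf {d : G.Dart} {x : Plane} (hx : x ∈ D.openEdge d) :
    (𝓝[D.leftHalf d] x).NeBot :=
  neBot_nhdsWithin_leftOf_of_mem (D.point_ne d) (openSegment_subset_segment _ _ _ hx)

theorem Face.subset_compl (F : D.Face) : F.1 ⊆ D.carrierᶜ := by
  obtain ⟨_, x, hx, rfl⟩ := F
  exact connectedComponentIn_subset _ _

theorem Face.comp_eq (F : D.Face) {x : Plane} (hx : x ∈ F.1) : D.comp x = F.1 := by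
  obtain ⟨_, y, hy, rfl⟩ := F
  exact (connectedComponentIn_eq hx).symm

theorem Face.isPreconnected (F : D.Face) : IsPreconnected F.1 := by
  obtain ⟨_, y, hy, rfl⟩ := F
  exact isPreconnected_connectedComponentIn

theorem Face.nonempty (F : D.Face) : F.1.Nonempty := by
  obtain ⟨_, y, hy, rfl⟩ := F
  exact ⟨y, mem_connectedComponentIn hy⟩

theorem eq_of_eventually_nhdsWithin_compl {α : Type*} {g : Set Plane → α} {c : α} {x : Plane}
    (hx : x ∉ D.carrier) (h : ∀ᶠ y in 𝓝[D.carrierᶜ] x, g (D.comp y) = c) : g (D.comp x) = c :=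
  h.self_of_nhdsWithin hx

section Finite

variable [Finite V]

/-- For suitable `A` and `B` this is the part of the drawing away from a given edge or vertex; since
it is closed, it can be avoided locally. -/
theorem IsStraightLine.isCompact_union (hD : D.IsStraightLine) (A : Set V) (B : Set G.edgeSet) :
    IsCompact (D.point '' A ∪ ⋃ e ∈ B, D.curve e) :=
  ((Set.toFinite A).image _).isCompact.union
    ((Set.toFinite B).isCompact_biUnion fun e _ => hD.isCompact_curve e)

theorem IsStraightLine.isCompact_carrier (hD : D.IsStraightLine) : IsCompact D.carrier := by
  have := hD.isCompact_union univ univ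
  simpa [carrier] using this

theorem IsStraightLine.isOpen_compl (hD : D.IsStraightLine) : IsOpen D.carrierᶜ :=
  hD.isCompact_carrier.isClosed.isOpen_compl

/-- Near an inner point of an edge, the drawing consists of this edge. -/
theorem IsStraightLine.eventually_mem_or (hD : D.IsStraightLine) {d : G.Dart} {x : Plane}
    (hx : x ∈ D.openEdge d) : ∀ᶠ y in 𝓝 x, y ∈ D.carrier → y ∈ D.curve d.toEdge := by
  have hc := (hD.isCompact_union univ {d.toEdge}ᶜ).isClosed
  have hx' : x ∉ D.point '' univ ∪ ⋃ e ∈ ({d.toEdge}ᶜ : Set G.edgeSet), D.curve e := by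
    rintro (⟨v, -, rfl⟩ | h)
    · exact point_notMem_openEdge d v hD hx
    · simp only [mem_iUnion] at h
      obtain ⟨e, he, h⟩ := h
      obtain ⟨v, -, -, rfl⟩ := D.curve_inter e d.toEdge he x ⟨h, hD.openEdge_subset_curve d hx⟩
      exact point_notMem_openEdge d v hD hx
  filter_upwards [hc.isOpen_compl.mem_nhds hx'] with y hy hyc
  rcases hyc with ⟨v, rfl⟩ | h
  · exact absurd (Or.inl ⟨v, mem_univ _, rfl⟩) hy
  · obtain ⟨e, he⟩ := mem_iUnion.1 h
    by_cases hed : e = d.toEdge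
    · exact hed ▸ he
    · exact absurd (Or.inr (mem_biUnion (show e ∈ ({d.toEdge}ᶜ : Set G.edgeSet) from hed) he)) hy

/-- Near a vertex, the drawing consists of the edges at this vertex. -/
theorem IsStraightLine.eventually_exists_dart (hD : D.IsStraightLine) (v : V) :
    ∀ᶠ y in 𝓝 (D.point v), y ∈ D.carrier →
      y = D.point v ∨ ∃ d : G.Dart, d.fst = v ∧ y ∈ D.openEdge d := by
  have hc := (hD.isCompact_union {v}ᶜ {e | v ∉ (e : Sym2 V)}).isClosed
  have hx' : D.point v ∉ D.point '' {v}ᶜ ∪ ⋃ e ∈ {e : G.edgeSet | v ∉ (e : Sym2 V)}, D.curve e := by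
    rintro (⟨w, hw, h⟩ | h)
    · exact hw (D.point_injective h)
    · simp only [mem_iUnion] at h
      obtain ⟨e, he, h⟩ := h
      exact he (D.point_mem_curve v e h)
  filter_upwards [hc.isOpen_compl.mem_nhds hx'] with y hy hyc
  have hpt : ∀ w, y = D.point w → w = v := fun w hw => by
    by_contra hne
    exact hy (Or.inl ⟨w, hne, hw.symm⟩)
  by_cases hyv : y = D.point v
  · exact Or.inl hyv
  right
  rcases hyc with ⟨w, rfl⟩ | h
  · rw [hpt w rfl] at hyv
    exact absurd rfl hyv
  · obtain ⟨e, he⟩ := mem_iUnion.1 h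
    by_cases hve : v ∈ (e : Sym2 V)
    · obtain ⟨d, rfl⟩ := SimpleGraph.Dart.exists_toEdge e
      have key : ∀ d : G.Dart, y ∈ D.curve d.toEdge → y ∈ D.openEdge d := by
        intro d hd
        rw [hD.curve_toEdge] at hd
        refine mem_openSegment_of_ne_left_right ?_ ?_ hd
        · rintro rfl
          exact hyv (by rw [hpt _ rfl])
        · rintro rfl
          exact hyv (by rw [hpt _ rfl])
      rcases Sym2.mem_iff.1 hve with h1 | h1
      · exact ⟨d, h1.symm, key d he⟩
      · exact ⟨d.symm, h1.symm, key d.symm (by rwa [SimpleGraph.Dart.toEdge_symm])⟩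
    · exact absurd (Or.inr (mem_biUnion (show e ∈ {e : G.edgeSet | v ∉ (e : Sym2 V)} from hve) he))
        hy

theorem IsStraightLine.eventually_notMem_carrier (hD : D.IsStraightLine) {d : G.Dart} {x : Plane}
    (hx : x ∈ D.openEdge d) : ∀ᶠ y in 𝓝 x, y ∈ D.leftHalf d → y ∉ D.carrier := by
  filter_upwards [hD.eventually_mem_or hx] with y hy hyl hyc
  exact leftHalf_disjoint_curve hD hyl (hy hyc)

theorem IsStraightLine.eventually_comp_eq (hD : D.IsStraightLine) {x : Plane}
    (hx : x ∉ D.carrier) : ∀ᶠ y in 𝓝 x, D.comp y = D.comp x := by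
  have : IsOpen (D.comp x) := hD.isOpen_compl.connectedComponentIn
  filter_upwards [this.mem_nhds (mem_comp hx)] with y hy
  exact (connectedComponentIn_eq hy).symm

/-- A small half disc to the left of an inner point of the edge is convex and misses the drawing, so
it lies in one face; this face stays the same along the open edge, which is connected. -/
theorem IsStraightLine.exists_leftFace (hD : D.IsStraightLine) (d : G.Dart) :
    ∃ F : D.Face, ∀ x ∈ D.openEdge d, ∀ᶠ y in 𝓝[D.leftHalf d] x, D.comp y = F.1 := by
  have key : ∀ x ∈ D.openEdge d, ∃ c : Set Plane,
      ∀ᶠ y in 𝓝[D.leftHalf d] x, D.comp y = c := by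
    intro x hx
    obtain ⟨r, hr, hrc⟩ := Metric.eventually_nhds_iff_ball.1 (hD.eventually_notMem_carrier hx)
    have hH : IsPreconnected (Metric.ball x r ∩ D.leftHalf d) :=
      ((convex_ball x r).inter (convex_leftOf _ _)).isPreconnected
    have hmem : Metric.ball x r ∩ D.leftHalf d ∈ 𝓝[D.leftHalf d] x :=
      inter_mem (nhdsWithin_le_nhds (Metric.ball_mem_nhds x hr)) self_mem_nhdsWithin
    have := neBot_leftHalf hx
    obtain ⟨z, hz⟩ := this.nonempty_of_mem hmem
    exact ⟨D.comp z, mem_of_superset hmem fun y hy =>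
      comp_eq_of_isPreconnected hH (fun w hw => hrc w hw.1 hw.2) hy hz⟩
  obtain ⟨c, hc⟩ := (convex_openSegment (D.point d.fst) (D.point d.snd)).isPreconnected
    |>.exists_eventually_nhdsWithin_eq (openEdge_nonempty d) D.comp
      (fun x hx => neBot_leftHalf hx) key
  obtain ⟨x, hx⟩ := openEdge_nonempty (D := D) d
  have := neBot_leftHalf hx
  obtain ⟨z, hz, hzc⟩ := ((hc x hx).and (eventually_nhdsWithin_iff.2
    (hD.eventually_notMem_carrier hx))).exists
  exact ⟨⟨c, z, hzc, hz.symm⟩, hc⟩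

/-- The face on the left of a directed edge. -/
noncomputable def IsStraightLine.leftFace (hD : D.IsStraightLine) (d : G.Dart) : D.Face :=
  (hD.exists_leftFace d).choose

theorem IsStraightLine.eventually_leftFace (hD : D.IsStraightLine) {d : G.Dart} {x : Plane}
    (hx : x ∈ D.openEdge d) : ∀ᶠ y in 𝓝[D.leftHalf d] x, D.comp y = (hD.leftFace d).1 :=
  (hD.exists_leftFace d).choose_spec x hx

theorem IsStraightLine.isOpen_face (hD : D.IsStraightLine) (F : D.Face) : IsOpen F.1 := by
  obtain ⟨_, y, hy, rfl⟩ := F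
  exact hD.isOpen_compl.connectedComponentIn

theorem IsStraightLine.eventually_mem_leftFace (hD : D.IsStraightLine) {d : G.Dart} {x : Plane}
    (hx : x ∈ D.openEdge d) : ∀ᶠ y in 𝓝[D.leftHalf d] x, y ∈ (hD.leftFace d).1 := by
  filter_upwards [hD.eventually_leftFace hx,
    eventually_nhdsWithin_iff.2 (hD.eventually_notMem_carrier hx)] with y h1 h2
  exact h1 ▸ mem_comp h2

theorem IsStraightLine.eventually_comp (hD : D.IsStraightLine) {d : G.Dart} {x : Plane}
    (hx : x ∈ D.openEdge d) : ∀ᶠ y in 𝓝[D.carrierᶜ] x,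
      D.comp y = (hD.leftFace d).1 ∨ D.comp y = (hD.leftFace d.symm).1 := by
  have hx' : x ∈ D.openEdge d.symm := by rwa [openEdge_symm]
  have h1 := eventually_nhdsWithin_iff.1 (hD.eventually_leftFace hx)
  have h2 := eventually_nhdsWithin_iff.1 (hD.eventually_leftFace hx')
  rw [eventually_nhdsWithin_iff]
  filter_upwards [hD.eventually_mem_leftHalf_or hx, h1, h2] with y h3 h4 h5 hyc
  exact (h3 hyc).imp h4 h5

theorem IsStraightLine.openEdge_subset_closure (hD : D.IsStraightLine) (d : G.Dart) :
    D.openEdge d ⊆ closure (hD.leftFace d).1 := by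
  intro x hx
  have := neBot_leftHalf hx
  rw [mem_closure_iff_frequently]
  exact ((hD.eventually_mem_leftFace hx).frequently).filter_mono nhdsWithin_le_nhds

/-- Only the two side faces come near an inner point of an edge. Conversely, the closure of a side
face contains the open edge, hence the closed one. -/
theorem IsStraightLine.mem_boundaryEdges_iff (hD : D.IsStraightLine) (F : D.Face) (d : G.Dart) :
    d.toEdge ∈ F.boundaryEdges ↔ hD.leftFace d = F ∨ hD.leftFace d.symm = F := by
  constructor
  · intro h
    obtain ⟨x, hx⟩ := openEdge_nonempty (D := D) d
    have hxF : x ∈ closure F.1 := frontier_subset_closure (h (hD.openEdge_subset_curve d hx))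
    have h1 : ∃ᶠ y in 𝓝 x, y ∈ F.1 := mem_closure_iff_frequently.1 hxF
    obtain ⟨y, hy, h2⟩ := (h1.and_eventually
      (eventually_nhdsWithin_iff.1 (hD.eventually_comp hx))).exists
    rw [F.comp_eq hy] at h2
    exact (h2 (F.subset_compl hy)).imp (fun h => Subtype.ext h.symm) fun h => Subtype.ext h.symm
  · have key : ∀ d : G.Dart, d.toEdge ∈ (hD.leftFace d).boundaryEdges := by
      intro d x hx
      rw [(hD.isOpen_face _).frontier_eq]
      refine ⟨?_, fun h => (hD.leftFace d).subset_compl h (curve_subset_carrier _ hx)⟩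
      rw [hD.curve_toEdge, ← closure_openSegment] at hx
      exact closure_minimal (hD.openEdge_subset_closure d) isClosed_closure hx
    rintro (rfl | rfl)
    · exact key d
    · simpa [SimpleGraph.Dart.toEdge_symm] using key d.symm

theorem IsStraightLine.neBot_compl (hD : D.IsStraightLine) {d : G.Dart} {x : Plane}
    (hx : x ∈ D.openEdge d) : (𝓝[D.carrierᶜ] x).NeBot := by
  have := neBot_leftHalf hx
  have h : ∃ᶠ y in 𝓝[D.leftHalf d] x, y ∉ D.carrier :=
    (eventually_nhdsWithin_iff.2 (hD.eventually_notMem_carrier hx)).frequently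
  rw [← mem_closure_iff_nhdsWithin_neBot, mem_closure_iff_frequently]
  exact h.filter_mono nhdsWithin_le_nhds

/-- If a function on the faces takes the same value on the two sides of an edge, then it is
constant near the inner points of this edge. -/
theorem IsStraightLine.eventually_eq_of_noJump (hD : D.IsStraightLine) {α : Type*}
    (g : Set Plane → α) {d : G.Dart} {x : Plane} (hx : x ∈ D.openEdge d)
    (h : g (hD.leftFace d).1 = g (hD.leftFace d.symm).1) :
    ∀ᶠ y in 𝓝[D.carrierᶜ] x, g (D.comp y) = g (hD.leftFace d).1 := by
  filter_upwards [hD.eventually_comp hx] with y hy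
  rcases hy with hy | hy
  · rw [hy]
  · rw [hy, h]

/-- The set `S` may cross the drawing, provided that it does so at inner points of edges without a
jump. Germs relative to the complement of the drawing still make sense there. -/
theorem IsStraightLine.exists_eventually_eq (hD : D.IsStraightLine) {α : Type*}
    (g : Set Plane → α) {S : Set Plane} (hS : IsPreconnected S) (hne : S.Nonempty)
    (h : ∀ x ∈ S, x ∈ D.carrier → ∃ d : G.Dart, x ∈ D.openEdge d ∧
      g (hD.leftFace d).1 = g (hD.leftFace d.symm).1) :
    ∃ c, ∀ x ∈ S, ∀ᶠ y in 𝓝[D.carrierᶜ] x, g (D.comp y) = c := by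
  refine hS.exists_eventually_nhdsWithin_eq hne (fun y => g (D.comp y)) ?_ ?_
  · intro x hx
    by_cases hxc : x ∈ D.carrier
    · obtain ⟨d, hd, -⟩ := h x hx hxc
      exact hD.neBot_compl hd
    · rw [← mem_closure_iff_nhdsWithin_neBot]
      exact subset_closure hxc
  · intro x hx
    by_cases hxc : x ∈ D.carrier
    · obtain ⟨d, hd, hg⟩ := h x hx hxc
      exact ⟨_, hD.eventually_eq_of_noJump g hd hg⟩
    · exact ⟨g (D.comp x), nhdsWithin_le_nhds
        ((hD.eventually_comp_eq hxc).mono fun y hy => by rw [hy])⟩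

/-- A function on the faces that does not jump at any edge is constant. -/
theorem IsStraightLine.eq_of_forall_noJump (hD : D.IsStraightLine) {α : Type*}
    (g : Set Plane → α) (h : ∀ d, g (hD.leftFace d).1 = g (hD.leftFace d.symm).1)
    (F F' : D.Face) : g F.1 = g F'.1 := by
  have hrank : 1 < Module.rank ℝ Plane := by
    apply Module.lt_rank_of_lt_finrank
    simp
  -- The plane without the finitely many vertices is connected and meets the drawing only at inner
  -- points of edges.
  have hS := (Set.finite_range D.point).countable.isConnected_compl_of_one_lt_rank hrank
  obtain ⟨c, hc⟩ := hD.exists_eventually_eq g hS.isPreconnected hS.nonempty (by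
    intro x hx hxc
    rcases hxc with hxc | hxc
    · exact absurd hxc hx
    · obtain ⟨e, he⟩ := mem_iUnion.1 hxc
      obtain ⟨d, rfl⟩ := SimpleGraph.Dart.exists_toEdge e
      rw [hD.curve_toEdge] at he
      exact ⟨d, mem_openSegment_of_ne_left_right (fun h => hx ⟨_, h⟩) (fun h => hx ⟨_, h⟩) he,
        h d⟩)
  have key : ∀ F : D.Face, g F.1 = c := by
    intro F
    obtain ⟨x, hx⟩ := F.nonempty
    rw [← F.comp_eq hx]
    have := F.subset_compl hx
    exact eq_of_eventually_nhdsWithin_compl this (hc x fun h => this (Or.inl h))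
  rw [key, key]

/-- A function on the faces cannot jump at exactly one edge at a vertex, and it is constant near
a vertex if it does not jump there. -/
theorem IsStraightLine.exists_eq_of_noJump_of_ne (hD : D.IsStraightLine) {α : Type*}
    (g : Set Plane → α) (d₀ : G.Dart)
    (h : ∀ d : G.Dart, d.fst = d₀.fst → d ≠ d₀ →
      g (hD.leftFace d).1 = g (hD.leftFace d.symm).1) :
    ∃ c, g (hD.leftFace d₀).1 = c ∧ g (hD.leftFace d₀.symm).1 = c ∧
      ∀ᶠ y in 𝓝 (D.point d₀.fst), y ∉ D.carrier → g (D.comp y) = c := by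
  set p := D.point d₀.fst with hp
  set q := D.point d₀.snd with hq
  have hpq : p ≠ q := D.point_ne d₀
  have hcoe : ∀ z, coord p q ((coordHomeomorph hpq).symm z) = z :=
    (coordHomeomorph hpq).apply_symm_apply
  obtain ⟨r, hr, hr1, hrc⟩ : ∃ r : ℝ, 0 < r ∧ r < 1 ∧ ∀ y, ‖coord p q y‖ < r → y ∈ D.carrier →
      y = p ∨ ∃ d : G.Dart, d.fst = d₀.fst ∧ y ∈ D.openEdge d := by
    have h1 := hD.eventually_exists_dart d₀.fst
    have h0 : (coordHomeomorph hpq).symm 0 = p := by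
      rw [Homeomorph.symm_apply_eq]
      exact (coord_left p q).symm
    rw [← hp, ← h0] at h1
    obtain ⟨r, hr, h2⟩ := Metric.eventually_nhds_iff.1
      (((coordHomeomorph hpq).symm.continuous.tendsto 0).eventually h1)
    -- A radius below 1, the coordinate of the other end of `d₀`, makes the ray through `d₀`
    -- coincide with the edge inside the disc.
    refine ⟨min r (1 / 2), by positivity, by linarith [min_le_right r (1 / 2)], fun y hy => ?_⟩
    have h3 := h2 (y := coord p q y) (by
      rw [dist_zero_right]
      exact hy.trans_le (min_le_left _ _))
    rw [show (coordHomeomorph hpq).symm (coord p q y) = y from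
      (coordHomeomorph hpq).symm_apply_apply y, h0] at h3
    exact h3
  -- The disc around the vertex, cut along `d₀`, is connected and crosses only edges without a jump.
  -- Both sides of `d₀` lie in it, so they carry the same value.
  have hS := isPreconnected_ball_diff_ray hpq hr
  set S := {x | ‖coord p q x‖ < r ∧ -coord p q x ∈ Complex.slitPlane} with hSdef
  obtain ⟨c, hc⟩ := hD.exists_eventually_eq g hS (by
      refine ⟨(coordHomeomorph hpq).symm (-(r / 2 : ℝ)), ?_⟩
      rw [hSdef, mem_ofPred_eq, hcoe]
      refine ⟨?_, Complex.mem_slitPlane_iff.2 (Or.inl ?_)⟩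
      · rw [norm_neg, Complex.norm_real, Real.norm_of_nonneg (by positivity)]
        linarith
      · simpa using hr) (by
      intro x hx hxc
      rcases hrc x hx.1 hxc with rfl | ⟨d, hdv, hd⟩
      · have h1 := hx.2
        rw [coord_left, neg_zero] at h1
        exact absurd rfl (Complex.slitPlane_ne_zero h1)
      · refine ⟨d, hd, h d hdv ?_⟩
        rintro rfl
        obtain ⟨h1, h2, -⟩ := (mem_openSegment_iff hpq).1 hd
        rcases Complex.mem_slitPlane_iff.1 hx.2 with h3 | h3
        · rw [Complex.neg_re] at h3
          linarith
        · rw [Complex.neg_im, h1, neg_zero] at h3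
          exact h3 rfl)
  have hval : ∀ y ∈ S, y ∉ D.carrier → g (D.comp y) = c := fun y hy hyc =>
    eq_of_eventually_nhdsWithin_compl hyc (hc y hy)
  set x₀ := (coordHomeomorph hpq).symm (r / 2 : ℝ) with hx₀
  have hx₀c : coord p q x₀ = (r / 2 : ℝ) := hcoe _
  have hx₀e : x₀ ∈ D.openEdge d₀ := by
    refine (mem_openSegment_iff hpq).2 ?_
    rw [hx₀c]
    refine ⟨Complex.ofReal_im _, ?_, ?_⟩ <;> rw [Complex.ofReal_re] <;> linarith
  have hnear : ∀ᶠ y in 𝓝 x₀, ‖coord p q y‖ < r := by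
    refine (continuous_coord p q).norm.continuousAt.eventually_lt_const ?_
    change ‖coord p q x₀‖ < r
    rw [hx₀c, Complex.norm_real, Real.norm_of_nonneg (by positivity)]
    linarith
  have side : ∀ d : G.Dart, x₀ ∈ D.openEdge d →
      (∀ y ∈ D.leftHalf d, (coord p q y).im ≠ 0) → g (hD.leftFace d).1 = c := by
    intro d hd him
    have := neBot_leftHalf hd
    obtain ⟨y, ⟨h1, h3, h4⟩, h2⟩ := (((hD.eventually_leftFace hd).and
      (nhdsWithin_le_nhds ((hD.eventually_notMem_carrier hd).and hnear))).and
      self_mem_nhdsWithin).exists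
    rw [← h1]
    refine hval y ⟨h4, Complex.mem_slitPlane_iff.2 (Or.inr ?_)⟩ (h3 h2)
    rw [Complex.neg_im]
    exact neg_ne_zero.2 (him y h2)
  refine ⟨c, side d₀ hx₀e fun y hy => ne_of_gt hy, side d₀.symm (by rwa [openEdge_symm])
    fun y hy => ((mem_leftOf_swap hpq).1 hy).ne, ?_⟩
  have hnear' : ∀ᶠ y in 𝓝 p, ‖coord p q y‖ < r :=
    (continuous_coord p q).norm.continuousAt.eventually_lt_const (by simpa [coord_left] using hr)
  filter_upwards [hnear'] with y hy hyc
  refine hval y ⟨hy, ?_⟩ hyc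
  by_contra hns
  rw [Complex.mem_slitPlane_iff, not_or, not_lt, not_not, Complex.neg_re, Complex.neg_im] at hns
  refine hyc (curve_subset_carrier d₀.toEdge ?_)
  rw [hD.curve_toEdge]
  refine (mem_segment_iff hpq).2 ⟨by linarith [hns.2], by linarith [hns.1], ?_⟩
  linarith [Complex.re_le_norm (coord p q y)]

end Finite

end PlanarDrawing

/-! ### The oriented incidence matrix -/

namespace SimpleGraph

variable {V : Type*} {G : SimpleGraph V}

/-- The incidence matrix of a graph with respect to an orientation of its edges. -/
def orientedIncidence (K : Type*) [Ring K] [DecidableEq V] (o : G.edgeSet → G.Dart) :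
    Matrix G.edgeSet V K :=
  Matrix.of fun e v => (if (o e).fst = v then 1 else 0) - (if (o e).snd = v then 1 else 0)

theorem orientedIncidence_mulVec {K : Type*} [Ring K] [DecidableEq V] [Fintype V]
    (o : G.edgeSet → G.Dart) (θ : V → K) (e : G.edgeSet) :
    (orientedIncidence K o).mulVec θ e = θ (o e).fst - θ (o e).snd := by
  simp [orientedIncidence, Matrix.mulVec, dotProduct, sub_mul, Finset.sum_sub_distrib]

end SimpleGraph

/-! ### The angle under which a segment is seen -/

namespace Plane

variable {p q x : Plane}

/-- The oriented angle under which the segment from `p` to `q` is seen from `x`. -/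
noncomputable def viewAngle (p q x : Plane) : ℝ :=
  Complex.arg ((toComplex q - toComplex x) / (toComplex p - toComplex x))

/-- With `p` as 0 and `q` as 1 the ratio is (1 - z)/(-z). It is a nonpositive real exactly when z is
in (0, 1], so the cut of `arg` becomes the segment. -/
theorem ratio_eq (h : p ≠ q) (hx : x ≠ p) :
    (toComplex q - toComplex x) / (toComplex p - toComplex x) = 1 - (coord p q x)⁻¹ := by
  have h1 := toComplex_sub_ne_zero h
  have h2 := toComplex_sub_ne_zero hx
  have h3 := toComplex_sub_ne_zero hx.symm
  unfold coord
  field_simp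
  ring

theorem coord_ne_zero (h : p ≠ q) (hx : x ≠ p) : coord p q x ≠ 0 := by
  rw [← coord_left p q]
  exact fun h' => hx (coord_injective h h')

theorem continuousAt_ratio (hx : x ≠ p) : ContinuousAt
    (fun y => (toComplex q - toComplex y) / (toComplex p - toComplex y)) x := by
  have h2 := toComplex_sub_ne_zero hx
  refine ContinuousAt.div ?_ ?_ h2
  · exact (continuous_const.sub toComplex.continuous).continuousAt
  · exact (continuous_const.sub toComplex.continuous).continuousAt

theorem continuousAt_viewAngle (h : p ≠ q) (hx : x ∉ segment ℝ p q) :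
    ContinuousAt (viewAngle p q) x := by
  have hxp : x ≠ p := by
    rintro rfl
    exact hx (left_mem_segment ℝ _ _)
  refine ContinuousAt.comp (g := Complex.arg) (Complex.continuousAt_arg ?_)
    (continuousAt_ratio hxp)
  by_contra hs
  apply hx
  rw [ratio_eq h hxp, Complex.mem_slitPlane_iff, not_or, not_lt, not_not] at hs
  have h0 := coord_ne_zero h hxp
  set w := (coord p q x)⁻¹ with hw
  have hwc : coord p q x = w⁻¹ := by rw [hw, inv_inv]
  have h1 : w.im = 0 := by simpa using hs.2
  have h2 : 1 ≤ w.re := by simpa using hs.1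
  have h3 : w = (w.re : ℂ) := Complex.ext rfl (by simpa using h1)
  rw [mem_segment_iff h, hwc, h3, ← Complex.ofReal_inv]
  refine ⟨Complex.ofReal_im _, ?_, ?_⟩
  · rw [Complex.ofReal_re]
    positivity
  · rw [Complex.ofReal_re]
    exact inv_le_one_of_one_le₀ h2

/-- On the open segment the ratio is a negative real, and nearby its imaginary part has the sign of
that of `coord p q`; so `arg` approaches its cut from above on the left and from below on the right.
-/
theorem tendsto_viewAngle_left (h : p ≠ q) (hx : x ∈ openSegment ℝ p q) :
    Tendsto (viewAngle p q) (𝓝[leftOf p q] x) (𝓝 Real.pi) ∧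
      Tendsto (viewAngle p q) (𝓝[leftOf q p] x) (𝓝 (-Real.pi)) := by
  obtain ⟨h1, h2, h3⟩ := (mem_openSegment_iff h).1 hx
  have hxp : x ≠ p := by
    rintro rfl
    simp [coord_left] at h2
  have hc := continuousAt_ratio (q := q) hxp
  have hnp : ∀ᶠ y in 𝓝 x, y ≠ p := isOpen_ne.mem_nhds hxp
  have hval := ratio_eq h hxp
  have hcx : coord p q x = ((coord p q x).re : ℂ) := Complex.ext rfl (by simpa using h1)
  have him : ((toComplex q - toComplex x) / (toComplex p - toComplex x)).im = 0 := by
    rw [hval, hcx, ← Complex.ofReal_inv]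
    simp
  have hre : ((toComplex q - toComplex x) / (toComplex p - toComplex x)).re < 0 := by
    rw [hval, hcx, ← Complex.ofReal_inv, Complex.sub_re, Complex.ofReal_re, Complex.one_re, sub_neg]
    exact (one_lt_inv₀ h2).2 h3
  have himy : ∀ y, y ≠ p → ((toComplex q - toComplex y) / (toComplex p - toComplex y)).im =
      (coord p q y).im / Complex.normSq (coord p q y) := by
    intro y hy
    rw [ratio_eq h hy]
    simp [Complex.inv_im, neg_div]
  constructor
  · refine (Complex.tendsto_arg_nhdsWithin_im_nonneg_of_re_neg_of_im_zero hre him).comp ?_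
    refine tendsto_nhdsWithin_iff.2 ⟨hc.tendsto.mono_left nhdsWithin_le_nhds, ?_⟩
    filter_upwards [nhdsWithin_le_nhds hnp, self_mem_nhdsWithin] with y hy hyl
    rw [himy y hy]
    exact div_nonneg (le_of_lt hyl) (Complex.normSq_nonneg _)
  · refine (Complex.tendsto_arg_nhdsWithin_im_neg_of_re_neg_of_im_zero hre him).comp ?_
    refine tendsto_nhdsWithin_iff.2 ⟨hc.tendsto.mono_left nhdsWithin_le_nhds, ?_⟩
    filter_upwards [nhdsWithin_le_nhds hnp, self_mem_nhdsWithin] with y hy hyl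
    rw [himy y hy]
    exact div_neg_of_neg_of_pos ((mem_leftOf_swap h).1 hyl)
      (Complex.normSq_pos.2 (coord_ne_zero h hy))

theorem continuousAt_arg_ratio_self (hx : x ≠ p) : ContinuousAt
    (fun y => Complex.arg ((toComplex p - toComplex y) / (toComplex p - toComplex x))) x := by
  have h2 := toComplex_sub_ne_zero hx
  refine ContinuousAt.comp (g := Complex.arg) (Complex.continuousAt_arg ?_) ?_
  · rw [div_self h2]
    exact Complex.one_mem_slitPlane
  · exact ((continuous_const.sub toComplex.continuous).div_const _).continuousAt

/-- Locally, the angle of view is a difference of a function of `q` and a function of `p`. -/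
theorem eventually_viewAngle_sub (h : p ≠ q) (hx : x ∉ segment ℝ p q) :
    ∀ᶠ y in 𝓝 x, viewAngle p q y - viewAngle p q x =
      Complex.arg ((toComplex q - toComplex y) / (toComplex q - toComplex x)) -
      Complex.arg ((toComplex p - toComplex y) / (toComplex p - toComplex x)) := by
  have hxp : x ≠ p := by
    rintro rfl
    exact hx (left_mem_segment ℝ _ _)
  have hxq : x ≠ q := by
    rintro rfl
    exact hx (right_mem_segment ℝ _ _)
  have hp0 := toComplex_sub_ne_zero hxp
  have hq0 := toComplex_sub_ne_zero hxq
  have hcont : ContinuousAt (fun y => |viewAngle p q y - viewAngle p q x -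
      (Complex.arg ((toComplex q - toComplex y) / (toComplex q - toComplex x)) -
      Complex.arg ((toComplex p - toComplex y) / (toComplex p - toComplex x)))|) x :=
    (((continuousAt_viewAngle h hx).sub continuousAt_const).sub
      ((continuousAt_arg_ratio_self hxq).sub (continuousAt_arg_ratio_self hxp))).abs
  -- The two sides agree modulo 2π. Their difference is continuous at `x` and vanishes there, so it
  -- is below 2π in absolute value nearby and must be 0.
  have hlt := hcont.eventually_lt_const (u := 2 * Real.pi) (by
    simp only [sub_self, div_self hp0, div_self hq0, Complex.arg_one, abs_zero]
    positivity)
  filter_upwards [hlt, isOpen_ne.mem_nhds hxp, isOpen_ne.mem_nhds hxq] with y hy hyp hyq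
  have hp1 := toComplex_sub_ne_zero hyp
  have hq1 := toComplex_sub_ne_zero hyq
  rw [← sub_eq_zero]
  set δ := viewAngle p q y - viewAngle p q x -
      (Complex.arg ((toComplex q - toComplex y) / (toComplex q - toComplex x)) -
      Complex.arg ((toComplex p - toComplex y) / (toComplex p - toComplex x))) with hδ
  have hangle : (δ : Real.Angle) = (0 : ℝ) := by
    rw [hδ]
    simp only [Real.Angle.coe_sub, viewAngle]
    rw [Complex.arg_div_coe_angle hq1 hp1, Complex.arg_div_coe_angle hq0 hp0,
      Complex.arg_div_coe_angle hq1 hq0, Complex.arg_div_coe_angle hp1 hp0, Real.Angle.coe_zero]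
    abel
  obtain ⟨k, hk⟩ := Real.Angle.angle_eq_iff_two_pi_dvd_sub.1 hangle
  rw [sub_zero] at hk
  rw [hk, abs_mul, abs_of_pos Real.two_pi_pos] at hy
  have h4 : |(k : ℝ)| < 1 := by
    by_contra h5
    rw [not_lt] at h5
    nlinarith [Real.two_pi_pos]
  have h5 : k = 0 := by
    rw [← Int.abs_lt_one_iff]
    exact_mod_cast h4
  rw [hk, h5, Int.cast_zero, mul_zero]

theorem tendsto_viewAngle_cobounded (h : p ≠ q) :
    Tendsto (viewAngle p q) (Bornology.cobounded Plane) (𝓝 0) := by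
  have h1 : Tendsto (coord p q) (Bornology.cobounded Plane) (Bornology.cobounded ℂ) := by
    rw [Metric.cobounded_eq_cocompact, Metric.cobounded_eq_cocompact]
    exact (coordHomeomorph h).isClosedEmbedding.tendsto_cocompact
  have h2 : Tendsto (fun y => 1 - (coord p q y)⁻¹) (Bornology.cobounded Plane) (𝓝 1) := by
    simpa using (tendsto_inv₀_cobounded.comp h1).const_sub (1 : ℂ)
  have h3 := (Complex.continuousAt_arg Complex.one_mem_slitPlane).tendsto.comp h2
  rw [Complex.arg_one] at h3
  refine h3.congr' ?_
  have h4 : ∀ᶠ y in Bornology.cobounded Plane, y ≠ p :=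
    Bornology.isBounded_def.1 (Bornology.isBounded_singleton (x := p))
  filter_upwards [h4] with y hy
  rw [viewAngle, ratio_eq h hy]
  rfl

end Plane

/-! ### Winding numbers of cycles around faces -/

namespace PlanarDrawing

open Plane

variable {V : Type*} {G : SimpleGraph V} {D : PlanarDrawing G} [Fintype V] [DecidableEq V]
  [Fintype G.edgeSet]

/-- The winding number, times `2π`, of a weighted family of directed edges around a point. -/
noncomputable def winding (D : PlanarDrawing G) (o : G.edgeSet → G.Dart) (Z : G.edgeSet → ℝ)
    (x : Plane) : ℝ :=
  ∑ e, Z e * viewAngle (D.point (o e).fst) (D.point (o e).snd) x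

variable {o : G.edgeSet → G.Dart} {Z : G.edgeSet → ℝ}

/-- Near `x` the changes of the angles of view are differences of a potential `θ` on the vertices,
and a cycle pairs to zero with such differences. -/
theorem IsStraightLine.eventually_winding_eq (hD : D.IsStraightLine)
    (hZ : Matrix.vecMul Z (SimpleGraph.orientedIncidence ℝ o) = 0) {x : Plane}
    (hx : x ∉ D.carrier) : ∀ᶠ y in 𝓝 x, D.winding o Z y = D.winding o Z x := by
  have h1 : ∀ e, ∀ᶠ y in 𝓝 x, _ := fun e => eventually_viewAngle_sub (D.point_ne (o e))
    (x := x) (by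
      rw [← hD.curve_toEdge]
      exact fun h => hx (curve_subset_carrier _ h))
  filter_upwards [eventually_all.2 h1] with y hy
  rw [← sub_eq_zero, winding, winding, ← Finset.sum_sub_distrib]
  simp only [← mul_sub]
  simp only [hy]
  set θ : V → ℝ := fun v => Complex.arg
    ((toComplex (D.point v) - toComplex y) / (toComplex (D.point v) - toComplex x))
  have h2 := Matrix.dotProduct_mulVec Z (SimpleGraph.orientedIncidence ℝ o) θ
  rw [hZ, zero_dotProduct] at h2
  rw [← neg_eq_zero, ← Finset.sum_neg_distrib, ← h2]
  refine Finset.sum_congr rfl fun e _ => ?_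
  rw [SimpleGraph.orientedIncidence_mulVec, ← mul_neg, neg_sub]

/-- The winding number around the points of a face. -/
noncomputable def faceWinding (D : PlanarDrawing G) (o : G.edgeSet → G.Dart) (Z : G.edgeSet → ℝ)
    (F : Set Plane) : ℝ :=
  open Classical in if h : F.Nonempty then D.winding o Z h.some else 0

theorem IsStraightLine.faceWinding_eq (hD : D.IsStraightLine)
    (hZ : Matrix.vecMul Z (SimpleGraph.orientedIncidence ℝ o) = 0) (F : D.Face) {x : Plane}
    (hx : x ∈ F.1) : D.faceWinding o Z F.1 = D.winding o Z x := by
  obtain ⟨c, hc⟩ := F.isPreconnected.exists_eventually_nhdsWithin_eq F.nonempty (T := univ)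
    (D.winding o Z) (fun x _ => by rw [nhdsWithin_univ]; infer_instance) (fun x hx => by
      rw [nhdsWithin_univ]
      exact ⟨_, hD.eventually_winding_eq hZ (F.subset_compl hx)⟩)
  simp only [nhdsWithin_univ] at hc
  rw [faceWinding, dif_pos F.nonempty, (hc _ F.nonempty.some_mem).self_of_nhds,
    (hc x hx).self_of_nhds]

/-- From the right of `o e` to its left, the angle of view of this edge rises from -π to π, while
those of all other edges are continuous at an inner point of `e`. -/
theorem IsStraightLine.faceWinding_jump (hD : D.IsStraightLine)
    (ho : ∀ e, (o e).toEdge = e)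
    (hZ : Matrix.vecMul Z (SimpleGraph.orientedIncidence ℝ o) = 0) (e : G.edgeSet) :
    D.faceWinding o Z (hD.leftFace (o e)).1 - D.faceWinding o Z (hD.leftFace (o e).symm).1 =
      2 * Real.pi * Z e := by
  obtain ⟨x, hx⟩ := openEdge_nonempty (D := D) (o e)
  have hx' : x ∈ D.openEdge (o e).symm := by rwa [openEdge_symm]
  have hrest : ContinuousAt (fun y => ∑ f ∈ Finset.univ \ {e},
      Z f * viewAngle (D.point (o f).fst) (D.point (o f).snd) y) x := by
    refine tendsto_finsetSum _ fun f hf => ?_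
    refine ContinuousAt.tendsto (continuousAt_const.mul
      (continuousAt_viewAngle (D.point_ne (o f)) fun hxf => ?_))
    rw [← hD.curve_toEdge, ho] at hxf
    have hxe := hD.openEdge_subset_curve _ hx
    rw [ho] at hxe
    obtain ⟨v, -, -, rfl⟩ := D.curve_inter f e (by simpa using hf) x ⟨hxf, hxe⟩
    exact point_notMem_openEdge _ v hD hx
  have hsplit : ∀ y, D.winding o Z y = Z e * viewAngle (D.point (o e).fst) (D.point (o e).snd) y +
      ∑ f ∈ Finset.univ \ {e}, Z f * viewAngle (D.point (o f).fst) (D.point (o f).snd) y :=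
    fun y => Finset.sum_eq_add_sum_sdiff_singleton_of_mem (Finset.mem_univ e) _
  obtain ⟨hl, hr⟩ := tendsto_viewAngle_left (D.point_ne (o e)) hx
  have key : ∀ (d : G.Dart) (a : ℝ), x ∈ D.openEdge d →
      Tendsto (viewAngle (D.point (o e).fst) (D.point (o e).snd)) (𝓝[D.leftHalf d] x) (𝓝 a) →
      D.faceWinding o Z (hD.leftFace d).1 = Z e * a + ∑ f ∈ Finset.univ \ {e},
        Z f * viewAngle (D.point (o f).fst) (D.point (o f).snd) x := by
    intro d a hd ht
    have := neBot_leftHalf hd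
    have h1 := (ht.const_mul (Z e)).add (hrest.tendsto.mono_left nhdsWithin_le_nhds)
    refine tendsto_nhds_unique (tendsto_const_nhds.congr' ?_) h1
    filter_upwards [hD.eventually_mem_leftFace hd] with y hy
    rw [hD.faceWinding_eq hZ _ hy, hsplit]
  rw [key _ _ hx hl, key _ _ hx' hr]
  ring

/-- Winding numbers tend to 0 at infinity, so a nonzero value can be taken only on a bounded set. -/
theorem IsStraightLine.faceWinding_eq_zero (hD : D.IsStraightLine)
    (hZ : Matrix.vecMul Z (SimpleGraph.orientedIncidence ℝ o) = 0) (F : D.Face)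
    (hF : ¬ F.IsInternal) : D.faceWinding o Z F.1 = 0 := by
  have h1 : Tendsto (D.winding o Z) (Bornology.cobounded Plane) (𝓝 0) := by
    have : Tendsto (D.winding o Z) (Bornology.cobounded Plane) (𝓝 (∑ e, Z e * 0)) :=
      tendsto_finsetSum _ fun e _ => (tendsto_viewAngle_cobounded (D.point_ne (o e))).const_mul _
    simpa using this
  by_contra hne
  have h2 : {x | D.winding o Z x = D.faceWinding o Z F.1}ᶜ ∈ Bornology.cobounded Plane :=
    h1.eventually_ne (Ne.symm hne)
  exact hF ((Bornology.isBounded_def.2 h2).subset fun x hx => (hD.faceWinding_eq hZ F hx).symm)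

end PlanarDrawing

/-! ### The cycle space and cycles in 2-connected graphs -/

namespace SimpleGraph

variable {V : Type*} {G : SimpleGraph V}

theorem exists_orientation (G : SimpleGraph V) :
    ∃ o : G.edgeSet → G.Dart, ∀ e, (o e).toEdge = e :=
  ⟨fun e => (Dart.exists_toEdge e).choose, fun e => (Dart.exists_toEdge e).choose_spec⟩

theorem Dart.toEdge_ne {a b : G.Dart} (hab : a ≠ b) (h : a.fst = b.fst) : a.toEdge ≠ b.toEdge := by
  intro h'
  rcases (Dart.toEdge_eq_iff _ _).1 h' with h1 | h1
  · exact hab h1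
  · rw [h1] at h
    exact b.snd_ne_fst h

theorem Connected.exists_dart_of_ne (hG : G.Connected) {v w : V} (h : v ≠ w) :
    ∃ d : G.Dart, d.fst = v := by
  obtain ⟨p⟩ := hG.preconnected v w
  cases p with
  | nil => exact absurd rfl h
  | cons h p => exact ⟨⟨(_, _), h⟩, rfl⟩

theorem IsTwoConnected.exists_notMem_pair [Fintype V] (hG : G.IsTwoConnected) (u v : V) :
    ∃ w, w ≠ u ∧ w ≠ v := by
  classical
  have h1 := hG.1
  rw [ENat.card_eq_coe_fintype_card] at h1
  have h2 : 3 ≤ Fintype.card V := by exact_mod_cast h1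
  obtain ⟨w, -, hw⟩ := Finset.exists_mem_notMem_of_card_lt_card
    (s := ({u, v} : Finset V)) (t := Finset.univ)
    (Finset.card_le_two.trans_lt (by rw [Finset.card_univ]; omega))
  exact ⟨w, fun h => hw (by simp [h]), fun h => hw (by simp [h])⟩

/-- In a 2-connected graph all degrees are at least 2. -/
theorem IsTwoConnected.exists_dart_ne [Fintype V] (hG : G.IsTwoConnected) (a : G.Dart) :
    ∃ b : G.Dart, a ≠ b ∧ a.fst = b.fst := by
  obtain ⟨w, hw1, hw2⟩ := hG.exists_notMem_pair a.fst a.snd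
  obtain ⟨d, hd⟩ := (hG.2.2 a.snd).exists_dart_of_ne (v := ⟨a.fst, a.fst_ne_snd⟩)
    (w := ⟨w, hw2⟩) fun h => hw1 (congrArg Subtype.val h).symm
  refine ⟨⟨(d.fst, d.snd), d.adj⟩, ?_, ?_⟩
  · intro h
    exact d.snd.2 (congrArg (fun a : G.Dart => a.snd) h).symm
  · exact (congrArg Subtype.val hd).symm

theorem IsTwoConnected.exists_dart [Fintype V] (hG : G.IsTwoConnected) (v : V) :
    ∃ d : G.Dart, d.fst = v := by
  obtain ⟨w, hw, -⟩ := hG.exists_notMem_pair v v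
  exact hG.2.1.exists_dart_of_ne hw.symm

variable [DecidableEq V] [Fintype G.edgeSet] {K : Type*} [Field K]
  {o : G.edgeSet → G.Dart}

/-- The cycle space of a graph over a field: the vectors in the kernel of the boundary map. -/
noncomputable def cycleSpace (K : Type*) [Field K] (o : G.edgeSet → G.Dart) :
    Submodule K (G.edgeSet → K) :=
  LinearMap.ker (orientedIncidence K o).transpose.mulVecLin

theorem mem_cycleSpace {Z : G.edgeSet → K} :
    Z ∈ cycleSpace K o ↔ Matrix.vecMul Z (orientedIncidence K o) = 0 := by
  rw [cycleSpace, LinearMap.mem_ker, Matrix.mulVecLin_apply, Matrix.mulVec_transpose]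

/-- The incidence matrix and its transpose have the same rank. By connectedness the kernel of the
former consists of the constants; the kernel of the latter is the cycle space. -/
theorem finrank_cycleSpace_add_card [Fintype V] (ho : ∀ e, (o e).toEdge = e) (hG : G.Connected) :
    Module.finrank K (cycleSpace K o) + Fintype.card V = Fintype.card G.edgeSet + 1 := by
  have hker : LinearMap.ker (orientedIncidence K o).mulVecLin = K ∙ (1 : V → K) := by
    ext θ
    rw [LinearMap.mem_ker, Submodule.mem_span_singleton]
    constructor
    · intro h
      have hadj : ∀ u w, G.Adj u w → θ u = θ w := by
        intro u w huw
        have h1 := congrFun h (Dart.toEdge ⟨(u, w), huw⟩)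
        rw [Matrix.mulVecLin_apply, orientedIncidence_mulVec, Pi.zero_apply, sub_eq_zero] at h1
        rcases (Dart.toEdge_eq_iff _ _).1 (ho (Dart.toEdge ⟨(u, w), huw⟩)) with h2 | h2
        · rw [h2] at h1
          exact h1
        · rw [h2] at h1
          exact h1.symm
      have hconst : ∀ u w, θ u = θ w := by
        intro u w
        obtain ⟨p⟩ := hG.preconnected u w
        induction p with
        | nil => rfl
        | cons h p ih => exact (hadj _ _ h).trans ih
      obtain ⟨v⟩ := hG.nonempty
      refine ⟨θ v, ?_⟩
      ext w
      simp [hconst w v]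
    · rintro ⟨c, rfl⟩
      ext e
      rw [Matrix.mulVecLin_apply, orientedIncidence_mulVec]
      simp
  have hV : (1 : V → K) ≠ 0 := by
    obtain ⟨v⟩ := hG.nonempty
    exact fun h => one_ne_zero (congrFun h v)
  have h1 := LinearMap.finrank_range_add_finrank_ker (orientedIncidence K o).mulVecLin
  have h2 := LinearMap.finrank_range_add_finrank_ker (orientedIncidence K o).transpose.mulVecLin
  have h3 := Matrix.rank_transpose (orientedIncidence K o)
  rw [hker, finrank_span_singleton hV, Module.finrank_fintype_fun_eq_card] at h1
  rw [Module.finrank_fintype_fun_eq_card] at h2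
  unfold Matrix.rank at h3
  unfold cycleSpace
  omega

/-- The chain of a directed edge. -/
def dartChain [DecidableEq G.Dart] [DecidableEq G.edgeSet] (K : Type*) [Ring K]
    (o : G.edgeSet → G.Dart) (d : G.Dart) : G.edgeSet → K :=
  Pi.single d.toEdge (if o d.toEdge = d then 1 else -1)

variable [DecidableEq G.Dart] [DecidableEq G.edgeSet]

theorem dartChain_vecMul (ho : ∀ e, (o e).toEdge = e) (d : G.Dart) :
    Matrix.vecMul (dartChain K o d) (orientedIncidence K o) =
      Pi.single d.fst 1 - Pi.single d.snd 1 := by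
  ext v
  rw [dartChain, Matrix.single_vecMul]
  simp only [orientedIncidence, Matrix.row_apply, Matrix.of_apply, Pi.smul_apply,
    Pi.sub_apply, Pi.single_apply]
  rcases (Dart.toEdge_eq_iff _ _).1 (ho d.toEdge) with h | h
  · simp [h, eq_comm]
  · have : d.symm ≠ d := d.symm_ne
    simp [h, this, eq_comm]

theorem exists_chain_of_walk (K : Type*) [Field K] (ho : ∀ e, (o e).toEdge = e) {u w : V}
    (p : G.Walk u w) :
    ∃ Z : G.edgeSet → K, Matrix.vecMul Z (orientedIncidence K o) =
      Pi.single u 1 - Pi.single w 1 ∧ ∀ e : G.edgeSet, (e : Sym2 V) ∉ p.edges → Z e = 0 := by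
  induction p with
  | nil => exact ⟨0, by simp, fun _ _ => rfl⟩
  | cons h p ih =>
    obtain ⟨Z, h1, h2⟩ := ih
    refine ⟨dartChain K o ⟨(_, _), h⟩ + Z, ?_, fun e he => ?_⟩
    · rw [Matrix.add_vecMul, dartChain_vecMul ho, h1]
      simp
    · rw [Walk.edges_cons, List.mem_cons, not_or] at he
      rw [Pi.add_apply, h2 e he.2, dartChain, Pi.single_eq_of_ne, add_zero]
      exact fun h' => he.1 (congrArg Subtype.val h')

/-- The edges of a closed trail form a cycle modulo 2. -/
theorem indicator_trail_vecMul (ho : ∀ e, (o e).toEdge = e) {u w : V} (p : G.Walk u w)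
    (hp : p.IsTrail) :
    Matrix.vecMul (fun e : G.edgeSet => if (e : Sym2 V) ∈ p.edges then (1 : ZMod 2) else 0)
      (orientedIncidence (ZMod 2) o) = Pi.single u 1 - Pi.single w 1 := by
  induction p with
  | nil =>
    rw [sub_self, show (fun e : G.edgeSet => if (e : Sym2 V) ∈ (Walk.nil : G.Walk _ _).edges then
      (1 : ZMod 2) else 0) = 0 from funext fun e => by simp]
    exact Matrix.zero_vecMul _
  | @cons a b c h p ih =>
    rw [Walk.isTrail_cons] at hp
    have h1 : (fun e : G.edgeSet =>
        if (e : Sym2 V) ∈ (Walk.cons h p).edges then (1 : ZMod 2) else 0) =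
        dartChain (ZMod 2) o ⟨(a, b), h⟩ +
          fun e : G.edgeSet => if (e : Sym2 V) ∈ p.edges then (1 : ZMod 2) else 0 := by
      ext e
      have hneg : (-1 : ZMod 2) = 1 := by decide
      rw [Pi.add_apply, dartChain, hneg, ite_self, Walk.edges_cons]
      by_cases he : e = Dart.toEdge ⟨(a, b), h⟩
      · subst he
        have : ((Dart.toEdge ⟨(a, b), h⟩ : G.edgeSet) : Sym2 V) = s(a, b) := rfl
        simp [this, hp.2]
      · have : (e : Sym2 V) ≠ s(a, b) := fun h' => he (Subtype.ext h')
        simp [this, he]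
    rw [h1, Matrix.add_vecMul, dartChain_vecMul ho, ih hp.1]
    simp

/-- Two edges at a vertex of a 2-connected graph are on a common cycle. -/
theorem IsTwoConnected.exists_cycle [Fintype V] (hG : G.IsTwoConnected) (ho : ∀ e, (o e).toEdge = e)
    {a b : G.Dart} (hab : a ≠ b) (h : a.fst = b.fst) :
    ∃ Z : G.edgeSet → ℝ, Matrix.vecMul Z (orientedIncidence ℝ o) = 0 ∧
      ∀ d : G.Dart, d.fst = a.fst → (Z d.toEdge ≠ 0 ↔ d = a ∨ d = b) := by
  set v := a.fst with hv
  have hne := Dart.toEdge_ne hab h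
  -- A walk between the far ends that avoids `v` is closed up by `a` and `b`, which are then the
  -- only edges used at `v`.
  obtain ⟨p⟩ := (hG.2.2 v).preconnected ⟨a.snd, a.snd_ne_fst⟩ ⟨b.snd, h ▸ b.snd_ne_fst⟩
  obtain ⟨Z, hZ, hZ0⟩ := exists_chain_of_walk ℝ ho
    (p.map (Embedding.induce (G := G) ({v}ᶜ : Set V)).toHom)
  have hZv : ∀ d : G.Dart, d.fst = v → Z d.toEdge = 0 := by
    intro d hd
    refine hZ0 _ fun hmem => ?_
    rw [Walk.edges_map, List.mem_map] at hmem
    obtain ⟨e, -, he⟩ := hmem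
    have h1 : v ∈ (d.toEdge : Sym2 V) := hd ▸ Sym2.mem_mk_left _ _
    rw [← he, Sym2.mem_map] at h1
    obtain ⟨x, -, hx⟩ := h1
    exact x.2 hx
  refine ⟨dartChain ℝ o a + Z - dartChain ℝ o b, ?_, fun d hd => ?_⟩
  · rw [Matrix.sub_vecMul, Matrix.add_vecMul, dartChain_vecMul ho, dartChain_vecMul ho, ← h,
      ← hv, hZ]
    change Pi.single v 1 - Pi.single a.snd 1 + (Pi.single a.snd 1 - Pi.single b.snd 1) -
      (Pi.single v 1 - Pi.single b.snd 1) = 0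
    abel
  · rw [Pi.sub_apply, Pi.add_apply, hZv d hd, add_zero, dartChain, dartChain]
    by_cases hda : d = a
    · subst hda
      rw [Pi.single_eq_same, Pi.single_eq_of_ne hne]
      split_ifs <;> simp
    · by_cases hdb : d = b
      · subst hdb
        rw [Pi.single_eq_same, Pi.single_eq_of_ne hne.symm]
        split_ifs <;> simp
      · rw [Pi.single_eq_of_ne (Dart.toEdge_ne hda hd),
          Pi.single_eq_of_ne (Dart.toEdge_ne hdb (hd.trans h))]
        simp [hda, hdb]

end SimpleGraph

/-! ### The outer face and its boundary -/

namespace PlanarDrawing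

open Plane

variable {V : Type*} {G : SimpleGraph V} {D : PlanarDrawing G}

theorem Face.val_inj {F F' : D.Face} : F.1 = F'.1 ↔ F = F' := Subtype.ext_iff.symm

theorem IsStraightLine.carrier_subset_convexHull (hD : D.IsStraightLine) :
    D.carrier ⊆ convexHull ℝ (Set.range D.point) := by
  rintro x (hx | hx)
  · exact subset_convexHull ℝ _ hx
  · obtain ⟨e, he⟩ := mem_iUnion.1 hx
    obtain ⟨d, rfl⟩ := SimpleGraph.Dart.exists_toEdge e
    rw [hD.curve_toEdge] at he
    exact (convex_convexHull ℝ _).segment_subset (subset_convexHull ℝ _ (mem_range_self _))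
      (subset_convexHull ℝ _ (mem_range_self _)) he

section Finite

variable [Finite V]

/-- The exterior of a large disc is connected and misses the drawing, so it lies in one face; every
unbounded face meets it. -/
theorem IsStraightLine.exists_outer (hD : D.IsStraightLine) :
    ∃ F₀ : D.Face, ¬ F₀.IsInternal ∧ ∀ F : D.Face, ¬ F.IsInternal → F = F₀ := by
  have hrank : 1 < Module.rank ℝ Plane := by
    apply Module.lt_rank_of_lt_finrank
    simp
  obtain ⟨R, hR0, hR⟩ : ∃ R : ℝ, 0 ≤ R ∧ D.carrier ⊆ Metric.closedBall 0 R := by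
    obtain ⟨R, hR⟩ := hD.isCompact_carrier.isBounded.subset_closedBall (0 : Plane)
    exact ⟨max R 0, le_max_right _ _,
      hR.trans (Metric.closedBall_subset_closedBall (le_max_left _ _))⟩
  have hsub : (Metric.closedBall (0 : Plane) R)ᶜ ⊆ D.carrierᶜ := compl_subset_compl.2 hR
  have hconn := isPreconnected_compl_closedBall_zero hrank hR0
  have hunb : ∀ s : Set Plane, ¬ Bornology.IsBounded s →
      (s ∩ (Metric.closedBall (0 : Plane) R)ᶜ).Nonempty := by
    intro s hs
    by_contra h
    rw [not_nonempty_iff_eq_empty, ← disjoint_iff_inter_eq_empty, disjoint_compl_right_iff_subset]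
      at h
    exact hs (Metric.isBounded_closedBall.subset h)
  have huniv : ¬ Bornology.IsBounded (univ : Set Plane) := NormedSpace.unbounded_univ ℝ Plane
  obtain ⟨x, -, hx⟩ := hunb univ huniv
  have hxs := hconn.subset_connectedComponentIn hx hsub
  refine ⟨⟨D.comp x, x, hsub hx, rfl⟩, fun hb => ?_, fun F hF => ?_⟩
  · have hb' : Bornology.IsBounded (Metric.closedBall (0 : Plane) R)ᶜ := hb.subset hxs
    apply huniv
    rw [← union_compl_self (Metric.closedBall (0 : Plane) R)]
    exact Metric.isBounded_closedBall.union hb'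
  · obtain ⟨y, hyF, hy⟩ := hunb F.1 hF
    apply Subtype.ext
    rw [← F.comp_eq hyF]
    exact comp_eq_of_isPreconnected hconn hsub hy hx

/-- A half plane that contains `x` and misses the hull lies in the face of `x`, and a half plane is
unbounded. -/
theorem IsStraightLine.not_isInternal_of_notMem_convexHull [Nonempty V] (hD : D.IsStraightLine)
    (F : D.Face) {x : Plane} (hx : x ∈ F.1) (hxc : x ∉ convexHull ℝ (Set.range D.point)) :
    ¬ F.IsInternal := by
  intro hF
  have hclosed : IsClosed (convexHull ℝ (Set.range D.point)) :=
    (Set.finite_range D.point).isClosed_convexHull ℝ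
  obtain ⟨f, u, hfx, hfu⟩ := geometric_hahn_banach_point_closed (convex_convexHull ℝ _) hclosed hxc
  have hH : IsPreconnected {z | f z < u} :=
    (convex_halfSpace_lt f.toLinearMap.isLinear u).isPreconnected
  have hHc : {z | f z < u} ⊆ D.carrierᶜ := fun z hz hzc =>
    lt_asymm hz (hfu z (hD.carrier_subset_convexHull hzc))
  have hsub : {z | f z < u} ⊆ F.1 := by
    rw [← F.comp_eq hx]
    exact hH.subset_connectedComponentIn hfx hHc
  obtain ⟨C, hC⟩ := (hF.subset hsub).exists_norm_le
  obtain ⟨v⟩ := ‹Nonempty V›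
  set w := D.point v - x with hw
  have hfw : 0 < f w := by
    have := hfu _ (subset_convexHull ℝ _ ⟨v, rfl⟩)
    rw [hw, map_sub]
    linarith
  have hw0 : 0 < ‖w‖ := by
    rw [norm_pos_iff]
    intro h
    rw [h, map_zero] at hfw
    exact lt_irrefl _ hfw
  have hC0 : 0 ≤ C := (norm_nonneg _).trans (hC x hfx)
  -- This length takes `x - s • w`, which stays in the half plane, beyond the norm bound `C`.
  set s := (C + ‖x‖ + 1) / ‖w‖ with hs
  have hs0 : 0 < s := by positivity
  have h1 := hC (x - s • w) (by
    change f (x - s • w) < u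
    rw [map_sub, map_smul, smul_eq_mul]
    have := mul_pos hs0 hfw
    linarith)
  have h2 : ‖s • w‖ = C + ‖x‖ + 1 := by
    rw [norm_smul, Real.norm_of_nonneg hs0.le, hs, div_mul_cancel₀ _ hw0.ne']
  have h3 : ‖s • w‖ ≤ ‖x‖ + ‖x - s • w‖ := by
    have := norm_sub_le x (x - s • w)
    rwa [sub_sub_cancel] at this
  linarith

theorem IsStraightLine.point_mem_closure_outer [Nonempty V] (hD : D.IsStraightLine) {F₀ : D.Face}
    (hF₀ : ∀ F : D.Face, ¬ F.IsInternal → F = F₀) {v : V}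
    (hv : D.point v ∈ frontier (convexHull ℝ (Set.range D.point))) :
    D.point v ∈ closure F₀.1 := by
  rw [frontier_eq_closure_inter_closure] at hv
  refine closure_mono (fun x hx => ?_) hv.2
  have hxc : x ∉ D.carrier := fun h => hx (hD.carrier_subset_convexHull h)
  rw [← hF₀ ⟨D.comp x, x, hxc, rfl⟩
    (hD.not_isInternal_of_notMem_convexHull _ (mem_comp hxc) hx)]
  exact mem_comp hxc

theorem IsStraightLine.face_eq_of_forall_noJump (hD : D.IsStraightLine) {α : Type*}
    (g : D.Face → α) (h : ∀ d, g (hD.leftFace d) = g (hD.leftFace d.symm)) (F F' : D.Face) :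
    g F = g F' := by
  have hinj : Function.Injective fun E : D.Face => E.1 := fun _ _ => Face.val_inj.1
  have hext : ∀ E : D.Face, Function.extend (fun E : D.Face => E.1) g (fun _ => g F) E.1 = g E :=
    hinj.extend_apply _ _
  rw [← hext F, ← hext F']
  exact hD.eq_of_forall_noJump _ (fun d => by rw [hext, hext, h]) F F'

/-- A vertex on the boundary of a face is an end of an edge on the boundary of the face. -/
theorem IsStraightLine.exists_boundary_dart (hD : D.IsStraightLine) (F : D.Face) (d₀ : G.Dart)
    (hv : D.point d₀.fst ∈ closure F.1) :
    ∃ d : G.Dart, d.fst = d₀.fst ∧ d.toEdge ∈ F.boundaryEdges := by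
  by_contra! h
  simp only [hD.mem_boundaryEdges_iff, not_or] at h
  -- The predicate "is `F`" would jump at no edge here, so it would be constant near the vertex,
  -- where `F` does occur.
  obtain ⟨c, h1, h2, h3⟩ := hD.exists_eq_of_noJump_of_ne (fun S => S = F.1) d₀ (by
    intro d hd _
    have := h d hd
    rw [eq_iff_iff]
    exact iff_of_false (fun h => this.1 (Subtype.ext h)) fun h => this.2 (Subtype.ext h))
  obtain ⟨y, hy, hyc⟩ := ((mem_closure_iff_frequently.1 hv).and_eventually h3).exists
  have h4 := hyc (F.subset_compl hy)
  rw [F.comp_eq hy] at h4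
  rw [← h4] at h1 h2
  have h1' : (hD.leftFace d₀).1 = F.1 := by simpa using h1
  exact (h d₀ rfl).1 (Subtype.ext h1')

/-- An end of a boundary edge of a face is on a second boundary edge of the face. -/
theorem IsStraightLine.exists_boundary_dart_ne (hD : D.IsStraightLine) (F : D.Face) (d₀ : G.Dart)
    (hne : hD.leftFace d₀ ≠ hD.leftFace d₀.symm) (hd₀ : d₀.toEdge ∈ F.boundaryEdges) :
    ∃ d : G.Dart, d.fst = d₀.fst ∧ d ≠ d₀ ∧ d.toEdge ∈ F.boundaryEdges := by
  by_contra! h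
  simp only [hD.mem_boundaryEdges_iff, not_or] at h hd₀
  -- Otherwise the predicate "is `F`" would jump at `d₀` and at no other edge at this vertex.
  obtain ⟨c, h1, h2, -⟩ := hD.exists_eq_of_noJump_of_ne (fun S => S = F.1) d₀ (by
    intro d hd hdd
    have := h d hd hdd
    rw [eq_iff_iff]
    exact iff_of_false (fun h => this.1 (Subtype.ext h)) fun h => this.2 (Subtype.ext h))
  rw [← h2, eq_iff_iff, Face.val_inj, Face.val_inj] at h1
  rcases hd₀ with h3 | h3
  · exact hne (h3.trans (h1.1 h3).symm)
  · exact hne ((h1.2 h3).trans h3.symm)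

end Finite

section Fintype

variable [Fintype V] [DecidableEq V] [Fintype G.edgeSet] {o : G.edgeSet → G.Dart}

theorem IsStraightLine.faceWinding_eq_iff (hD : D.IsStraightLine) (ho : ∀ e, (o e).toEdge = e)
    {Z : G.edgeSet → ℝ} (hZ : Matrix.vecMul Z (SimpleGraph.orientedIncidence ℝ o) = 0)
    (d : G.Dart) : D.faceWinding o Z (hD.leftFace d).1 = D.faceWinding o Z (hD.leftFace d.symm).1 ↔
      Z d.toEdge = 0 := by
  have h := hD.faceWinding_jump ho hZ d.toEdge
  have hpi : 2 * Real.pi ≠ 0 := by positivity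
  rcases (SimpleGraph.Dart.toEdge_eq_iff _ _).1 (ho d.toEdge) with h1 | h1
  · rw [h1] at h
    rw [← sub_eq_zero, h, mul_eq_zero, or_iff_right hpi]
  · rw [h1, SimpleGraph.Dart.symm_symm] at h
    rw [eq_comm, ← sub_eq_zero, h, mul_eq_zero, or_iff_right hpi]

/-- By 2-connectedness some cycle uses `d`, and its winding numbers on the two sides of `d` differ.
-/
theorem IsStraightLine.leftFace_ne (hD : D.IsStraightLine) (hG : G.IsTwoConnected) (d : G.Dart) :
    hD.leftFace d ≠ hD.leftFace d.symm := by
  classical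
  obtain ⟨o, ho⟩ := G.exists_orientation
  obtain ⟨b, hb, hdb⟩ := hG.exists_dart_ne d
  obtain ⟨Z, hZ, hZd⟩ := hG.exists_cycle ho hb hdb
  intro h
  refine (hZd d rfl).2 (Or.inl rfl) ((hD.faceWinding_eq_iff ho hZ d).1 ?_)
  rw [h]

/-- The outer face has at most two boundary edges at every vertex. -/
theorem IsStraightLine.outer_boundary_darts (hD : D.IsStraightLine) (hG : G.IsTwoConnected)
    {F₀ : D.Face} (hF₀ : ¬ F₀.IsInternal) {a b c : G.Dart} (hab : a ≠ b) (hac : a ≠ c)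
    (hbc : b ≠ c) (hfb : a.fst = b.fst) (hfc : a.fst = c.fst) (ha : a.toEdge ∈ F₀.boundaryEdges)
    (hb : b.toEdge ∈ F₀.boundaryEdges) (hc : c.toEdge ∈ F₀.boundaryEdges) : False := by
  classical
  obtain ⟨o, ho⟩ := G.exists_orientation
  obtain ⟨Z, hZ, hZd⟩ := hG.exists_cycle ho hab hfb
  obtain ⟨Y, hY, hYd⟩ := hG.exists_cycle ho hac hfc
  have hZ0 := hD.faceWinding_eq_zero hZ F₀ hF₀
  have hY0 := hD.faceWinding_eq_zero hY F₀ hF₀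
  have zero_of : ∀ (X : G.edgeSet → ℝ),
      Matrix.vecMul X (SimpleGraph.orientedIncidence ℝ o) = 0 → ∀ d : G.Dart,
      d.toEdge ∈ F₀.boundaryEdges → X d.toEdge = 0 →
      D.faceWinding o X (hD.leftFace d).1 = 0 ∧ D.faceWinding o X (hD.leftFace d.symm).1 = 0 := by
    intro X hX d hd hXd
    have h1 := (hD.faceWinding_eq_iff ho hX d).2 hXd
    have h2 := hD.faceWinding_eq_zero hX F₀ hF₀
    rcases (hD.mem_boundaryEdges_iff F₀ d).1 hd with h3 | h3
    · rw [h3] at h1 ⊢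
      exact ⟨h2, h1 ▸ h2⟩
    · rw [h3] at h1 ⊢
      exact ⟨h1.trans h2, h2⟩
  -- The cycle `Z` uses `a` and `b` at the vertex, and `Y` uses `a` and `c`. At `b`, `Y` does not
  -- jump and is 0 on the outer side, so the predicate fails on both sides; likewise at `c` with
  -- `Z`. At `a` both cycles jump away from 0, so the predicate jumps there and nowhere else at the
  -- vertex.
  obtain ⟨C, h1, h2, -⟩ := hD.exists_eq_of_noJump_of_ne
    (fun S => D.faceWinding o Z S ≠ 0 ∧ D.faceWinding o Y S ≠ 0) a (by
    intro d hd hda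
    by_cases hdb : d = b
    · subst hdb
      have hz : Y d.toEdge = 0 := by
        by_contra hne
        rcases (hYd d hd).1 hne with h | h
        · exact hda h
        · exact hbc h
      obtain ⟨h3, h4⟩ := zero_of Y hY d hb hz
      simp [h3, h4]
    by_cases hdc : d = c
    · subst hdc
      have hz : Z d.toEdge = 0 := by
        by_contra hne
        rcases (hZd d hd).1 hne with h | h
        · exact hda h
        · exact hbc h.symm
      obtain ⟨h3, h4⟩ := zero_of Z hZ d hc hz
      simp [h3, h4]
    · have hz : Z d.toEdge = 0 := by
        by_contra hne
        rcases (hZd d hd).1 hne with h | h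
        · exact hda h
        · exact hdb h
      have hy : Y d.toEdge = 0 := by
        by_contra hne
        rcases (hYd d hd).1 hne with h | h
        · exact hda h
        · exact hdc h
      rw [(hD.faceWinding_eq_iff ho hZ d).2 hz, (hD.faceWinding_eq_iff ho hY d).2 hy])
  rw [← h2] at h1
  have h5 : ¬ D.faceWinding o Z (hD.leftFace a).1 = D.faceWinding o Z (hD.leftFace a.symm).1 :=
    fun h => (hZd a rfl).2 (Or.inl rfl) ((hD.faceWinding_eq_iff ho hZ a).1 h)
  have h6 : ¬ D.faceWinding o Y (hD.leftFace a).1 = D.faceWinding o Y (hD.leftFace a.symm).1 :=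
    fun h => (hYd a rfl).2 (Or.inl rfl) ((hD.faceWinding_eq_iff ho hY a).1 h)
  rcases (hD.mem_boundaryEdges_iff F₀ a).1 ha with h3 | h3
  · rw [h3] at h1 h5 h6
    rw [hZ0] at h1 h5
    rw [hY0] at h1 h6
    simp only [ne_eq, not_true_eq_false, and_self, eq_iff_iff, false_iff, not_and, not_not] at h1
    exact h6 (h1 (Ne.symm h5)).symm
  · rw [h3] at h1 h5 h6
    rw [hZ0] at h1 h5
    rw [hY0] at h1 h6
    simp only [ne_eq, not_true_eq_false, and_self, eq_iff_iff, iff_false, not_and, not_not] at h1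
    exact h6 (h1 h5)

end Fintype

end PlanarDrawing

/-! ### Counting edges and faces -/

namespace SimpleGraph

variable {V : Type*} {G : SimpleGraph V}

theorem Dart.exists_fst_eq (e : G.edgeSet) {v : V} (hv : v ∈ (e : Sym2 V)) :
    ∃ d : G.Dart, d.fst = v ∧ d.toEdge = e := by
  obtain ⟨d, rfl⟩ := Dart.exists_toEdge e
  rcases Sym2.mem_iff.1 hv with h | h
  · exact ⟨d, h.symm, rfl⟩
  · exact ⟨d.symm, h.symm, d.toEdge_symm⟩

theorem sum_card_incident [Fintype V] [DecidableEq V] (J : Finset G.edgeSet) :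
    ∑ v, (J.filter fun e : G.edgeSet => v ∈ (e : Sym2 V)).card = 2 * J.card := by
  simp only [Finset.card_filter]
  rw [Finset.sum_comm, mul_comm, ← smul_eq_mul, ← Finset.sum_const]
  refine Finset.sum_congr rfl fun e _ => ?_
  rw [← Finset.card_filter, ← Sym2.card_toFinset_of_not_isDiag _ (G.not_isDiag_of_mem_edgeSet e.2)]
  congr 1
  ext v
  simp

end SimpleGraph

namespace PlanarDrawing

open Plane

variable {V : Type*} {G : SimpleGraph V} {D : PlanarDrawing G}

open Classical in
theorem Face.IsGon.card_boundaryEdges [Fintype G.edgeSet] {F : D.Face} {k : ℕ} (hF : F.IsGon k) :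
    (Finset.univ.filter fun e => e ∈ F.boundaryEdges).card = k := by
  obtain ⟨v, w, hw, hk, he⟩ := hF
  rw [← hk, ← w.length_edges, ← List.toFinset_card_of_nodup hw.edges_nodup]
  refine Finset.card_bij (fun e _ => (e : Sym2 V)) ?_ (fun _ _ _ _ h => Subtype.ext h) ?_
  · intro e h
    rw [List.mem_toFinset]
    exact (he e).1 (Finset.mem_filter.1 h).2
  · intro e h
    rw [List.mem_toFinset] at h
    exact ⟨⟨e, w.edges_subset_edgeSet h⟩, Finset.mem_filter.2 ⟨Finset.mem_univ _, (he _).2 h⟩, rfl⟩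

/-- An internal face has a boundary edge, since `k` is nonzero, so it lies on the left of one of the
finitely many darts; only one other face exists. -/
theorem IsStraightLine.finite_face [Finite V] (hD : D.IsStraightLine) {k : ℕ} (hk : k ≠ 0)
    (h : D.InternalFacesAreGons k) : Finite D.Face := by
  classical
  have := Fintype.ofFinite V
  have := Fintype.ofFinite G.edgeSet
  obtain ⟨F₀, -, hF₀⟩ := hD.exists_outer
  have hfin : (range hD.leftFace ∪ {F₀}).Finite :=
    have : Finite G.Dart := Finite.of_injective _ SimpleGraph.Dart.toProd_injective
    (finite_range _).union (finite_singleton _)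
  refine Set.finite_univ_iff.1 (hfin.subset fun F _ => ?_)
  by_cases hF : F.IsInternal
  · left
    have h1 := (h F hF).card_boundaryEdges
    obtain ⟨e, he⟩ := Finset.card_pos.1 (h1 ▸ Nat.pos_of_ne_zero hk)
    obtain ⟨d, rfl⟩ := SimpleGraph.Dart.exists_toEdge e
    rcases (hD.mem_boundaryEdges_iff F d).1 (Finset.mem_filter.1 he).2 with h2 | h2
    · exact ⟨_, h2⟩
    · exact ⟨_, h2⟩
  · exact Or.inr (hF₀ F hF)

section Counting

/-- The internal faces of a drawing. -/
abbrev InternalFace (D : PlanarDrawing G) : Type := {F : D.Face // F.IsInternal}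

open Classical in
theorem sum_internalFace [Fintype D.InternalFace] {R : Type*} [Semiring R] (g : D.InternalFace → R)
    (X : D.Face) : ∑ F : D.InternalFace, g F * (if X = F.1 then 1 else 0) =
      if h : X.IsInternal then g ⟨X, h⟩ else 0 := by
  split_ifs with h
  · rw [Finset.sum_eq_single ⟨X, h⟩]
    · simp
    · intro F _ hF
      rw [if_neg, mul_zero]
      rintro rfl
      exact hF rfl
    · simp
  · refine Finset.sum_eq_zero fun F _ => ?_
    rw [if_neg, mul_zero]
    rintro rfl
    exact h F.2

variable [Fintype G.edgeSet] {o : G.edgeSet → G.Dart}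

theorem winding_add (Z Y : G.edgeSet → ℝ) (x : Plane) :
    D.winding o (Z + Y) x = D.winding o Z x + D.winding o Y x := by
  simp [winding, add_mul, Finset.sum_add_distrib]

theorem winding_smul (c : ℝ) (Z : G.edgeSet → ℝ) (x : Plane) :
    D.winding o (c • Z) x = c * D.winding o Z x := by
  simp [winding, mul_assoc, Finset.mul_sum]

/-- The map that takes a cycle to its winding numbers around the internal faces. -/
noncomputable def windingMap (D : PlanarDrawing G) (o : G.edgeSet → G.Dart) :
    (G.edgeSet → ℝ) →ₗ[ℝ] (D.InternalFace → ℝ) where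
  toFun Z F := D.faceWinding o Z F.1.1
  map_add' Z Y := by
    ext F
    simp [faceWinding, F.1.nonempty, winding_add]
  map_smul' c Z := by
    ext F
    simp [faceWinding, F.1.nonempty, winding_smul]

variable [Fintype V] [DecidableEq V]

/-- A cycle whose winding numbers all vanish has no jumps, so all its coefficients are 0. -/
theorem IsStraightLine.finrank_cycleSpace_le [Fintype D.InternalFace] (hD : D.IsStraightLine)
    (ho : ∀ e, (o e).toEdge = e) :
    Module.finrank ℝ (SimpleGraph.cycleSpace ℝ o) ≤ Fintype.card D.InternalFace := by
  have hinj : Function.Injective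
      ((D.windingMap o).domRestrict (SimpleGraph.cycleSpace ℝ o)) := by
    rw [← LinearMap.ker_eq_bot, LinearMap.ker_eq_bot']
    rintro ⟨Z, hZ⟩ h
    have hZ' := SimpleGraph.mem_cycleSpace.1 hZ
    have h0 : ∀ F : D.Face, D.faceWinding o Z F.1 = 0 := by
      intro F
      by_cases hF : F.IsInternal
      · exact congrFun h ⟨F, hF⟩
      · exact hD.faceWinding_eq_zero hZ' F hF
    ext e
    obtain ⟨d, rfl⟩ := SimpleGraph.Dart.exists_toEdge e
    exact (hD.faceWinding_eq_iff ho hZ' d).1 (by rw [h0, h0])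
  have := LinearMap.finrank_le_finrank_of_injective hinj
  rwa [Module.finrank_fintype_fun_eq_card] at this

open Classical in
theorem IsStraightLine.indicator_boundaryEdges (hD : D.IsStraightLine) (hG : G.IsTwoConnected)
    {R : Type*} [Semiring R] (F : D.Face) (d : G.Dart) :
    (if d.toEdge ∈ F.boundaryEdges then (1 : R) else 0) =
      (if hD.leftFace d = F then 1 else 0) + if hD.leftFace d.symm = F then 1 else 0 := by
  have hne := hD.leftFace_ne hG d
  rw [hD.mem_boundaryEdges_iff]
  by_cases h1 : hD.leftFace d = F
  · have h2 : hD.leftFace d.symm ≠ F := fun h => hne (h1.trans h.symm)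
    simp [h1, h2]
  · simp [h1]

/-- The coefficients of a linear relation between face boundaries, extended by 0 to the outer face,
jump at no edge; so they are constant, hence 0. Modulo 2 the boundaries are cycles without any
choice of orientation. -/
theorem IsStraightLine.card_internalFace_le [Fintype D.InternalFace] (hD : D.IsStraightLine)
    (hG : G.IsTwoConnected) (ho : ∀ e, (o e).toEdge = e) {k : ℕ}
    (hk : D.InternalFacesAreGons k) :
    Fintype.card D.InternalFace ≤ Module.finrank (ZMod 2) (SimpleGraph.cycleSpace (ZMod 2) o) := by
  classical
  set b : D.InternalFace → G.edgeSet → ZMod 2 :=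
    fun F e => if e ∈ F.1.boundaryEdges then 1 else 0 with hb
  have hmem : ∀ F, b F ∈ SimpleGraph.cycleSpace (ZMod 2) o := by
    intro F
    obtain ⟨v, w, hw, -, he⟩ := hk F.1 F.2
    rw [SimpleGraph.mem_cycleSpace]
    have h1 := SimpleGraph.indicator_trail_vecMul ho w hw.isCircuit.isTrail
    rw [sub_self] at h1
    rw [← h1, hb]
    simp only [he]
  obtain ⟨F₀, hF₀, -⟩ := hD.exists_outer
  have hli : LinearIndependent (ZMod 2)
      (fun F => (⟨b F, hmem F⟩ : SimpleGraph.cycleSpace (ZMod 2) o)) := by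
    rw [Fintype.linearIndependent_iff]
    intro g hg
    have hg' : ∑ F, g F • b F = 0 := by
      have := congrArg Subtype.val hg
      simpa using this
    have hconst := hD.face_eq_of_forall_noJump
      (fun X => if h : X.IsInternal then g ⟨X, h⟩ else 0) (by
        intro d
        have h1 := congrFun hg' d.toEdge
        simp only [Finset.sum_apply, Pi.smul_apply, smul_eq_mul, Pi.zero_apply, hb,
          hD.indicator_boundaryEdges hG, mul_add, Finset.sum_add_distrib, sum_internalFace] at h1
        rwa [← CharTwo.sub_eq_add, sub_eq_zero] at h1)
    intro F
    have h2 := hconst F.1 F₀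
    simpa [F.2, hF₀] using h2
  exact hli.fintype_card_le_finrank

open Classical in
-- Each edge has two different side faces, and each of these is either internal or `F₀`.
theorem IsStraightLine.card_add_card [Fintype D.InternalFace] (hD : D.IsStraightLine)
    (hG : G.IsTwoConnected) {k : ℕ} (hk : D.InternalFacesAreGons k) {F₀ : D.Face}
    (hF₀ : ¬ F₀.IsInternal) (hF₀' : ∀ F : D.Face, ¬ F.IsInternal → F = F₀) :
    Fintype.card D.InternalFace * k + (Finset.univ.filter fun e => e ∈ F₀.boundaryEdges).card =
      2 * Fintype.card G.edgeSet := by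
  have h1 : Fintype.card D.InternalFace * k =
      ∑ e : G.edgeSet, ∑ F : D.InternalFace, if e ∈ F.1.boundaryEdges then 1 else 0 := by
    rw [Finset.sum_comm]
    simp only [← Finset.card_filter]
    rw [Finset.sum_congr rfl fun F _ => (hk F.1 F.2).card_boundaryEdges]
    simp
  rw [h1, Finset.card_filter, ← Finset.sum_add_distrib, mul_comm, ← smul_eq_mul,
    ← Finset.card_univ, ← Finset.sum_const]
  refine Finset.sum_congr rfl fun e _ => ?_
  obtain ⟨d, rfl⟩ := SimpleGraph.Dart.exists_toEdge e
  have key : ∀ X : D.Face, (∑ F : D.InternalFace, if X = F.1 then 1 else 0) +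
      (if X = F₀ then 1 else 0) = 1 := by
    intro X
    have h2 := sum_internalFace (R := ℕ) (fun _ => 1) X
    simp only [one_mul] at h2
    rw [h2]
    by_cases hX : X.IsInternal
    · have : X ≠ F₀ := fun h => hF₀ (h ▸ hX)
      simp [hX, this]
    · simp [hF₀' X hX, hF₀]
  simp only [hD.indicator_boundaryEdges hG, Finset.sum_add_distrib]
  have h3 := key (hD.leftFace d)
  have h4 := key (hD.leftFace d.symm)
  omega

open Classical in
theorem IsStraightLine.card_outer_le (hD : D.IsStraightLine) (hG : G.IsTwoConnected)
    {F₀ : D.Face} (hF₀ : ¬ F₀.IsInternal) :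
    (Finset.univ.filter fun e => e ∈ F₀.boundaryEdges).card ≤ Fintype.card V := by
  have h1 := SimpleGraph.sum_card_incident (Finset.univ.filter fun e => e ∈ F₀.boundaryEdges)
  have h2 : ∀ v ∈ (Finset.univ : Finset V),
      ((Finset.univ.filter fun e => e ∈ F₀.boundaryEdges).filter
        fun e : G.edgeSet => v ∈ (e : Sym2 V)).card ≤ 2 := by
    intro v _
    by_contra! h
    obtain ⟨a, ha, b, hb, c, hc, hab, hac, hbc⟩ := Finset.two_lt_card.1 h
    simp only [Finset.mem_filter, Finset.mem_univ, true_and] at ha hb hc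
    obtain ⟨a, rfl, rfl⟩ := SimpleGraph.Dart.exists_fst_eq a ha.2
    obtain ⟨b, hb', rfl⟩ := SimpleGraph.Dart.exists_fst_eq b hb.2
    obtain ⟨c, hc', rfl⟩ := SimpleGraph.Dart.exists_fst_eq c hc.2
    exact hD.outer_boundary_darts hG hF₀ (fun h => hab (congrArg SimpleGraph.Dart.toEdge h))
      (fun h => hac (congrArg SimpleGraph.Dart.toEdge h))
      (fun h => hbc (congrArg SimpleGraph.Dart.toEdge h)) hb'.symm hc'.symm ha.1 hb.1 hc.1
  have h3 := Finset.sum_le_sum h2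
  rw [h1, Finset.sum_const, Finset.card_univ, smul_eq_mul] at h3
  omega

open Classical in
theorem IsStraightLine.card_hull_le [Nonempty V] (hD : D.IsStraightLine) (hG : G.IsTwoConnected)
    {F₀ : D.Face} (hF₀ : ∀ F : D.Face, ¬ F.IsInternal → F = F₀) :
    (Finset.univ.filter fun v =>
      D.point v ∈ frontier (convexHull ℝ (Set.range D.point))).card ≤
      (Finset.univ.filter fun e => e ∈ F₀.boundaryEdges).card := by
  set H := Finset.univ.filter fun v => D.point v ∈ frontier (convexHull ℝ (Set.range D.point))
  have h1 := SimpleGraph.sum_card_incident (Finset.univ.filter fun e => e ∈ F₀.boundaryEdges)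
  have h2 : ∀ v ∈ H, 2 ≤ ((Finset.univ.filter fun e => e ∈ F₀.boundaryEdges).filter
      fun e : G.edgeSet => v ∈ (e : Sym2 V)).card := by
    intro v hv
    have hcl := hD.point_mem_closure_outer hF₀ (Finset.mem_filter.1 hv).2
    obtain ⟨d₀, rfl⟩ := hG.exists_dart v
    obtain ⟨d, hd, hdF⟩ := hD.exists_boundary_dart F₀ d₀ hcl
    obtain ⟨d', hd', hne, hdF'⟩ := hD.exists_boundary_dart_ne F₀ d (hD.leftFace_ne hG d) hdF
    refine Finset.one_lt_card.2 ⟨d.toEdge, ?_, d'.toEdge, ?_,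
      SimpleGraph.Dart.toEdge_ne hne.symm hd'.symm⟩
    · simp only [Finset.mem_filter, Finset.mem_univ, true_and]
      exact ⟨hdF, hd ▸ Sym2.mem_mk_left _ _⟩
    · simp only [Finset.mem_filter, Finset.mem_univ, true_and]
      exact ⟨hdF', hd ▸ hd' ▸ Sym2.mem_mk_left _ _⟩
  have h3 := Finset.sum_le_sum h2
  have h4 := Finset.sum_le_sum_of_subset (f := fun v =>
    ((Finset.univ.filter fun e => e ∈ F₀.boundaryEdges).filter
      fun e : G.edgeSet => v ∈ (e : Sym2 V)).card)
    (Finset.subset_univ H)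
  rw [Finset.sum_const, smul_eq_mul] at h3
  simp only [h1] at h4
  omega

/-- Euler's formula and double counting: for a drawing of a 2-connected graph whose internal faces
are `k`-gons, there is a number between the number of points on the boundary of the convex hull and
the number of all points that satisfies the relation which the length of the outer face does. -/
theorem IsStraightLine.exists_outer_length (hD : D.IsStraightLine) (hG : G.IsTwoConnected) {k : ℕ}
    (hk0 : k ≠ 0) (hk : D.InternalFacesAreGons k) :
    ∃ m t : ℕ, m * k + t + 2 = 2 * m + 2 * Fintype.card V ∧ t ≤ Fintype.card V ∧
      {v | D.point v ∈ frontier (convexHull ℝ (Set.range D.point))}.ncard ≤ t := by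
  classical
  have := hD.finite_face hk0 hk
  have : Finite D.InternalFace := Subtype.finite
  have := Fintype.ofFinite D.InternalFace
  have : Nonempty V := hG.2.1.nonempty
  obtain ⟨o, ho⟩ := G.exists_orientation
  obtain ⟨F₀, hF₀, hF₀'⟩ := hD.exists_outer
  have h1 := hD.finrank_cycleSpace_le ho
  have h2 := hD.card_internalFace_le hG ho hk
  have h3 := SimpleGraph.finrank_cycleSpace_add_card (K := ℝ) ho hG.2.1
  have h4 := SimpleGraph.finrank_cycleSpace_add_card (K := ZMod 2) ho hG.2.1
  have h5 := hD.card_add_card hG hk hF₀ hF₀'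
  refine ⟨Fintype.card D.InternalFace, _, ?_, hD.card_outer_le hG hF₀, ?_⟩
  -- The dimension bounds `h1` and `h2` squeeze the number of internal faces to e - n + 1; this
  -- eliminates e from `h5`.
  · omega
  · have h6 := hD.card_hull_le hG hF₀'
    rwa [← Set.ncard_coe_finset, Finset.coe_filter_univ] at h6

end Counting

end PlanarDrawing

/-! ### The congruence argument -/

theorem proposition2 (k n j : ℕ) (hk : 3 ≤ k) (P : Finset Plane) (hP : InGeneralPosition P)
    (hn : P.card = n) (hkn : k ≤ n)
    {V : Type*} [Finite V] {G : SimpleGraph V} (𝒢 : PlaneGraph G)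
    (h𝒢 : 𝒢.IsAngulation k) (hadm : Admits P 𝒢)
    (hj : (j : ℤ) ≡ (k : ℤ) - (n : ℤ) [ZMOD ((k : ℤ) - 2)]) (hj' : (j : ℤ) ≤ (k : ℤ) - 3) :
    j ≤ (interiorPoints P).ncard := by
  classical
  have := Fintype.ofFinite V
  have := Fintype.ofFinite G.edgeSet
  obtain ⟨D, hD, hDP, rfl⟩ := hadm
  obtain ⟨hG, hgon⟩ := h𝒢
  obtain ⟨m, t, h1, h2, h3⟩ := hD.exists_outer_length hG (by omega) hgon
  have hcard : Fintype.card V = n := by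
    rw [← hn, ← Set.ncard_coe_finset, ← hDP, ← Set.image_univ,
      Set.ncard_image_of_injective _ D.point_injective, Set.ncard_univ, Nat.card_eq_fintype_card]
  rw [hcard] at h1 h2
  have h4 : (interiorPoints P).ncard + {v | D.point v ∈ frontier
      (convexHull ℝ (Set.range D.point))}.ncard = n := by
    have h5 : interiorPoints P = D.point '' {v | D.point v ∈ frontier
        (convexHull ℝ (Set.range D.point))}ᶜ := by
      ext p
      have hmem : p ∈ P ↔ p ∈ Set.range D.point := by rw [hDP, Finset.mem_coe]
      simp only [interiorPoints, Set.mem_ofPred_eq, hmem, ← hDP]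
      constructor
      · rintro ⟨⟨v, rfl⟩, hv⟩
        exact ⟨v, hv, rfl⟩
      · rintro ⟨v, hv, rfl⟩
        exact ⟨⟨v, rfl⟩, hv⟩
    rw [h5, Set.ncard_image_of_injective _ D.point_injective, add_comm,
      Set.ncard_add_ncard_compl, Nat.card_eq_fintype_card, hcard]
  obtain ⟨s, hs⟩ := hj.dvd
  zify at h1 h2 h3 h4 ⊢
  by_contra! hlt
  -- `n - t - j` is a multiple of `k - 2` that lies strictly between `-(k - 2)` and `0`
  have h6 : (n : ℤ) - t - j = (k - 2) * (m - 1 + s) := by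
    linear_combination hs - h1
  have h7 : (n : ℤ) - t - j < 0 := by linarith
  have h8 : -((k : ℤ) - 2) < (n : ℤ) - t - j := by linarith
  have hk' : (0 : ℤ) < k - 2 := by
    have : (3 : ℤ) ≤ k := by exact_mod_cast hk
    linarith
  rw [h6] at h7 h8
  have h9 : (m : ℤ) - 1 + s < 0 := by
    by_contra! h
    exact absurd h7 (not_lt.2 (mul_nonneg hk'.le h))
  have h10 : -1 < (m : ℤ) - 1 + s := by
    by_contra! h
    nlinarith
  omega
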